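/- Conventions. For a non-empty finite set $B\subset\mathbb Z^n$ with $N=\#B-1$, let $X_B\subset\mathbb P^N$ be the Zariski closure of the image of $\phi_B:(\mathbb C^\times)^n\to\mathbb P^N$, $t\mapsto[t^u]_{u\in B}$. A hyperplane $H\subset\mathbb P^N$ is tangent to $X\subset\mathbb P^N$ at $x$ if $H$ contains the embedded tangent space $\mathbb T_xX$. The dual variety $X^*\subset(\mathbb P^N)^\vee$ is the closure of the set of hyperplanes tangent to $X$ at some smooth point of $X$, and the dual defect is $\delta_X=N-1-\dim X^*$, where $\dim\emptyset=-1$. "General" means: outside a proper algebraic subset. Let $0\le r\le n$ and let $A_0,\dots,A_r\subset\mathbb Z^{n-r}$ be finite sets with Cayley sum $$A=A_0*\cdots*A_r:=\bigcup_{i=0}^r A_i\times\{e_i\}\subset\mathbb Z^{n-r}\times\mathbb Z^r,$$ where $e_0=0$ and $e_1,\dots,e_r$ is the standard basis of $\mathbb Z^r$. Assume that $A\neq\emptyset$ and that $A-A$ generates $\mathbb Z^{n-r}\times\mathbb Z^r$. Put $N=\#A-1$, let $X_{i,u}$ ($0\le i\le r$, $u\in A_i$) be the homogeneous coordinates of $\mathbb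 P^N$, and regard $(\mathbb C^\times)^{n-r}\times(\mathbb C^\times)^r$ as a subset of $X_A$ via $\phi_A$ and $(\mathbb C^\times)^r$ as its subtorus $\{1\}\times(\mathbb C^\times)^r$. Let $X^*_{A,1}\subset(\mathbb P^N)^\vee$ be the linear subvariety of hyperplanes tangent to $X_A$ at the unit element of the torus and, for a hyperplane $H$, let $Z^\circ_{A,H}\subset(\mathbb C^\times)^n$ be the set of points of the torus at which $H$ is tangent to $X_A$. Let $V_i=\langle A_i-A_i\rangle_{\mathbb Q}\subset\mathbb Q^{n-r}$, let $K$ be the kernel of $V_0\oplus\cdots\oplus V_r\to\mathbb Q^{n-r}$, $(m_0,\dots,m_r)\mapsto m_0+\cdots+m_r$, and let $$\alpha=\alpha(V_0,\dots,V_r)=\max\{\dim_{\mathbb Q}\langle m_0,\dots,m_r\rangle_{\mathbb Q} : (m_0,\dots,m_r)\in K\}.$$ For $H\in X^*_{A,1}$ with equation $\sum_{i,u}a_{i,u}X_{i,u}=0$ put $m_i=\sum_{u\in A_i}a_{i,u}\,u\in\mathbb C^{n-r}$. Then: (i) $m_i\in(V_i)_{\mathbb C}$ for all $i$, and $(m_0,\dots,m_r)\in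 K_{\mathbb C}$. (ii) If $H$ is general in $X^*_{A,1}$, then $(m_0,\dots,m_r)$ is general in $K_{\mathbb C}$. That is, for every proper algebraic subset $S\subsetneq K_{\mathbb C}$: for general $a$ in the linear space $L$ of coefficient vectors of hyperplanes in $X^*_{A,1}$ (with $0$ included) one has $(m_0,\dots,m_r)\notin S$; and a general $H\in X^*_{A,1}$ has an equation $a$ with $(m_0,\dots,m_r)\notin S$. (iii) $\dim\bigl(Z^\circ_{A,H}\cap(\mathbb C^\times)^r\bigr)=r-\alpha$ for general $H\in X^*_{A,1}$. Moreover $\delta_{X_A}\ge r-\alpha$. (iv) Suppose that there is a surjective group homomorphism $p:\mathbb Z^{n-r}\to\mathbb Z^{n-r-c}$ such that $p(A_0)*\cdots*p(A_r)$ is of join type, i.e. the map $\bigoplus_{i=0}^r\langle p(A_i)-p(A_i)\rangle\to\mathbb Z^{n-r-c}$, $(m_i)_i\mapsto\sum_i m_i$, is injective. Then $\alpha\le c$, and hence $\delta_{X_A}\ge r-c$. -/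

import Mathlib

open scoped Pointwise

noncomputable section

namespace CayleyContact

/-! ### Complex projective space, Zariski closure, dimension -/

/-- The projective space of lines in `ℂ^ι`.  Its points also stand for the hyperplanes of the
projective space: `[a]` is the hyperplane `∑ i, a i * X i = 0`. -/
abbrev ProjSpace (ι : Type) : Type := Projectivization ℂ (ι → ℂ)

/-- The affine cone over a subset of projective space (it always contains the origin). -/
def affineCone {ι : Type} (S : Set (ProjSpace ι)) : Set (ι → ℂ) :=
  {v | ∀ h : v ≠ 0, Projectivization.mk ℂ v h ∈ S}

/-- The (homogeneous) ideal of a subset of projective space: the ideal of its affine cone. -/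
def idealOf {ι : Type} (S : Set (ProjSpace ι)) : Ideal (MvPolynomial ι ℂ) :=
  MvPolynomial.vanishingIdeal ℂ (affineCone S)

/-- Zariski closure in projective space. -/
def zariskiClosure {ι : Type} (S : Set (ProjSpace ι)) : Set (ProjSpace ι) :=
  {P | P.rep ∈ MvPolynomial.zeroLocus ℂ (idealOf S)}

/-- Algebraic subsets of projective space. -/
def IsAlgebraicSet {ι : Type} (S : Set (ProjSpace ι)) : Prop :=
  zariskiClosure S = S

/-- Krull dimension of the homogeneous coordinate ring `ℂ[X] / I(S)`, as a natural number
(see `coe_coneDim`). -/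
def coneDim {ι : Type} (S : Set (ProjSpace ι)) : ℕ :=
  ((ringKrullDim (MvPolynomial ι ℂ ⧸ idealOf S)).unbotD 0).toNat

/-- The dimension of (the Zariski closure of) a subset of projective space; the empty set has
dimension `-1`. -/
def projDim {ι : Type} (S : Set (ProjSpace ι)) : ℤ :=
  (coneDim S : ℤ) - 1

theorem coe_coneDim {ι : Type} [Finite ι] (S : Set (ProjSpace ι)) :
    (coneDim S : WithBot ℕ∞) = ringKrullDim (MvPolynomial ι ℂ ⧸ idealOf S) := by
  have hne : idealOf S ≠ ⊤ := by
    intro h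
    have h1 : (1 : MvPolynomial ι ℂ) ∈ idealOf S := h ▸ Submodule.mem_top
    have h0 : (0 : ι → ℂ) ∈ affineCone S := fun h => absurd rfl h
    simpa using h1 0 h0
  have : Nontrivial (MvPolynomial ι ℂ ⧸ idealOf S) := Ideal.Quotient.nontrivial_iff.2 hne
  have hle := ringKrullDim_quotient_le (idealOf S)
  rw [MvPolynomial.ringKrullDim_of_isNoetherianRing, ringKrullDim_eq_zero_of_field] at hle
  have h0 : (0 : WithBot ℕ∞) ≤ ringKrullDim (MvPolynomial ι ℂ ⧸ idealOf S) :=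
    ringKrullDim_nonneg_of_nontrivial
  unfold coneDim
  generalize ringKrullDim (MvPolynomial ι ℂ ⧸ idealOf S) = x at hle h0
  induction x with
  | bot => simp at h0
  | coe x =>
    have hx : x ≠ ⊤ := by
      rintro rfl
      have h2 : ((⊤ : ℕ∞) : WithBot ℕ∞) ≤ ((Nat.card ι : ℕ∞) : WithBot ℕ∞) := by
        simpa using hle
      exact absurd (WithBot.coe_le_coe.1 h2) (by simp)
    lift x to ℕ using hx
    simp

/-- A property holds for general points of an irreducible `T`: it holds at all points of `T`
outside some algebraic set that does not contain `T` (no condition if `T` is empty). -/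
def HoldsGenerally {ι : Type} (T : Set (ProjSpace ι)) (p : ProjSpace ι → Prop) : Prop :=
  ∃ S : Set (ProjSpace ι), IsAlgebraicSet S ∧ (T.Nonempty → ¬ T ⊆ S) ∧ ∀ H ∈ T, H ∉ S → p H

/-! ### Tangency, dual variety, dual defect -/

/-- The affine cone over the embedded (projective) tangent space of `X` at `P`: the common
zeros of the linear forms `∑ i, (∂F/∂X_i)(P) X_i` for `F ∈ I(X)`. -/
def embTangent {ι : Type} [Fintype ι] (X : Set (ProjSpace ι)) (P : ProjSpace ι) :
    Submodule ℂ (ι → ℂ) where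
  carrier := {v | ∀ F ∈ idealOf X,
    ∑ i, MvPolynomial.eval P.rep (MvPolynomial.pderiv i F) * v i = 0}
  zero_mem' := by intro F _; simp
  add_mem' := by
    intro v w hv hw F hF
    simp [mul_add, Finset.sum_add_distrib, hv F hF, hw F hF]
  smul_mem' := by
    intro c v hv F hF
    have h : ∑ i, MvPolynomial.eval P.rep (MvPolynomial.pderiv i F) * (c • v) i
        = c * ∑ i, MvPolynomial.eval P.rep (MvPolynomial.pderiv i F) * v i := by
      rw [Finset.mul_sum]
      exact Finset.sum_congr rfl fun i _ => by simp only [Pi.smul_apply, smul_eq_mul]; ring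
    rw [h, hv F hF, mul_zero]

/-- The hyperplane `H` is tangent to `X` at `P`: it contains the embedded tangent space. -/
def IsTangentAt {ι : Type} [Fintype ι] (X : Set (ProjSpace ι)) (H P : ProjSpace ι) : Prop :=
  ∀ v ∈ embTangent X P, ∑ i, H.rep i * v i = 0

/-- Smooth points of an irreducible projective variety `X`: points of `X` at which the
embedded tangent space has the dimension of `X`. -/
def IsSmoothPoint {ι : Type} [Fintype ι] (X : Set (ProjSpace ι)) (P : ProjSpace ι) : Prop :=
  P ∈ X ∧ Module.finrank ℂ (embTangent X P) = coneDim X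

/-- The dual variety: closure of the set of hyperplanes tangent to `X` at some smooth point. -/
def dualVariety {ι : Type} [Fintype ι] (X : Set (ProjSpace ι)) : Set (ProjSpace ι) :=
  zariskiClosure {H | ∃ P, IsSmoothPoint X P ∧ IsTangentAt X H P}

/-- The dual defect `N - 1 - dim X^*` of `X ⊆ ℙ^N`, where `N = #ι - 1`. -/
def dualDefect {ι : Type} [Fintype ι] (X : Set (ProjSpace ι)) : ℤ :=
  ((Fintype.card ι : ℤ) - 1) - 1 - projDim (dualVariety X)

/-! ### The toric variety of a finite set of lattice points -/

section Toric

variable {σ : Type} [Fintype σ]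

/-- The vector `(t^u)_{u ∈ A}`, where `t^u = ∏ l, t_l ^ u_l`. -/
def monomialVec (A : Finset (σ → ℤ)) (t : σ → ℂˣ) : A → ℂ :=
  fun u => ((∏ l, t l ^ (u : σ → ℤ) l : ℂˣ) : ℂ)

theorem monomialVec_ne_zero {A : Finset (σ → ℤ)} (hA : A.Nonempty) (t : σ → ℂˣ) :
    monomialVec A t ≠ 0 := by
  obtain ⟨u, hu⟩ := hA
  intro h
  exact (∏ l, t l ^ u l : ℂˣ).ne_zero (congrFun h ⟨u, hu⟩)

/-- The morphism `φ_A : (ℂ^×)^σ → ℙ^N`, `t ↦ [t^u]_{u ∈ A}`. -/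
def torusMap (A : Finset (σ → ℤ)) (hA : A.Nonempty) (t : σ → ℂˣ) : ProjSpace A :=
  Projectivization.mk ℂ (monomialVec A t) (monomialVec_ne_zero hA t)

/-- The toric variety `X_A`: the closure of the image of `φ_A`. -/
def toricVariety (A : Finset (σ → ℤ)) (hA : A.Nonempty) : Set (ProjSpace A) :=
  zariskiClosure (Set.range (torusMap A hA))

/-- `Z°_{A,H}`: the points of the torus at which `H` is tangent to `X_A`. -/
def openContactLocus (A : Finset (σ → ℤ)) (hA : A.Nonempty) (H : ProjSpace A) :
    Set (σ → ℂˣ) :=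
  {t | IsTangentAt (toricVariety A hA) H (torusMap A hA t)}

/-- `X^*_{A,1}`: the hyperplanes tangent to `X_A` at the unit element of the torus. -/
def tangentHyperplanesAtOne (A : Finset (σ → ℤ)) (hA : A.Nonempty) : Set (ProjSpace A) :=
  {H | IsTangentAt (toricVariety A hA) H (torusMap A hA 1)}

end Toric

/-! ### Cayley sums -/

/-- The point `(u, e_i) ∈ ℤ^d × ℤ^r`, where `e_0 = 0` and `e_1, …, e_r` is the standard basis. -/
def cayleyPoint {d r : ℕ} (i : Fin (r + 1)) (u : Fin d → ℤ) : Fin d ⊕ Fin r → ℤ :=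
  Sum.elim u (fun l => if i = l.succ then 1 else 0)

/-- The Cayley sum `A_0 * ⋯ * A_r ⊆ ℤ^d × ℤ^r`. -/
def cayleySum {d r : ℕ} (A : Fin (r + 1) → Finset (Fin d → ℤ)) :
    Finset (Fin d ⊕ Fin r → ℤ) :=
  Finset.univ.biUnion fun i => (A i).image (cayleyPoint i)

theorem cayleyPoint_mem {d r : ℕ} (A : Fin (r + 1) → Finset (Fin d → ℤ)) (i : Fin (r + 1))
    (u : A i) : cayleyPoint i (u : Fin d → ℤ) ∈ cayleySum A :=
  Finset.mem_biUnion.2 ⟨i, Finset.mem_univ i, Finset.mem_image_of_mem _ u.2⟩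

/-- The Cayley sum of the `A_i` is of join type: the sum of the groups `⟨A_i - A_i⟩` is direct. -/
def IsJoinType {d r : ℕ} (A : Fin (r + 1) → Finset (Fin d → ℤ)) : Prop :=
  Function.Injective
    (fun m : (i : Fin (r + 1)) →
        AddSubgroup.closure ((A i : Set (Fin d → ℤ)) - (A i : Set (Fin d → ℤ))) =>
      ∑ i, (m i : Fin d → ℤ))

/-- `m_i = ∑_{u ∈ A_i} a_{(u, e_i)} u ∈ ℂ^d`, for a coefficient vector `a` of a linear form. -/
def moments {d r : ℕ} (A : Fin (r + 1) → Finset (Fin d → ℤ)) (a : cayleySum A → ℂ) :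
    Fin (r + 1) → Fin d → ℂ :=
  fun i l => ∑ u : A i,
    a ⟨cayleyPoint i (u : Fin d → ℤ), cayleyPoint_mem A i u⟩ * (((u : Fin d → ℤ) l : ℤ) : ℂ)

/-! ### The invariant `α` -/

/-- The kernel of `V_0 ⊕ ⋯ ⊕ V_r → V`, as a subspace of `V^{r+1}`. -/
def sumKernel {k V : Type} [Field k] [AddCommGroup V] [Module k V] {r : ℕ}
    (W : Fin (r + 1) → Submodule k V) : Submodule k (Fin (r + 1) → V) where
  carrier := {m | (∀ i, m i ∈ W i) ∧ ∑ i, m i = 0}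
  zero_mem' := ⟨fun i => (W i).zero_mem, by simp⟩
  add_mem' := by
    rintro m m' ⟨h, hs⟩ ⟨h', hs'⟩
    exact ⟨fun i => (W i).add_mem (h i) (h' i), by simp [Finset.sum_add_distrib, hs, hs']⟩
  smul_mem' := by
    rintro c m ⟨h, hs⟩
    exact ⟨fun i => (W i).smul_mem c (h i), by simp [← Finset.smul_sum, hs]⟩

/-- `α(V_0, …, V_r)`: the maximum of `dim ⟨m_0, …, m_r⟩` over the kernel (these dimensions are
at most `r`). -/
def alphaInv {k V : Type} [Field k] [AddCommGroup V] [Module k V] {r : ℕ}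
    (W : Fin (r + 1) → Submodule k V) : ℕ :=
  sSup {s | ∃ m ∈ sumKernel W, s = Module.finrank k (Submodule.span k (Set.range m))}

/-- `V_i = ⟨A_i - A_i⟩_ℚ ⊆ ℚ^d`. -/
def diffSpan {d : ℕ} (B : Finset (Fin d → ℤ)) : Submodule ℚ (Fin d → ℚ) :=
  Submodule.span ℚ {w | ∃ u ∈ B, ∃ v ∈ B, w = fun l => ((u l - v l : ℤ) : ℚ)}

/-- `W_ℂ ⊆ ℂ^d` for a subspace `W ⊆ ℚ^d`. -/
def complexify {d : ℕ} (W : Submodule ℚ (Fin d → ℚ)) : Submodule ℂ (Fin d → ℂ) :=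
  Submodule.span ℂ ((fun w l => ((w l : ℚ) : ℂ)) '' (W : Set (Fin d → ℚ)))

/-- `K_ℂ ⊆ (ℂ^d)^{r+1}` for a subspace `K ⊆ (ℚ^d)^{r+1}`. -/
def complexifyTuple {d r : ℕ} (K : Submodule ℚ (Fin (r + 1) → Fin d → ℚ)) :
    Submodule ℂ (Fin (r + 1) → Fin d → ℂ) :=
  Submodule.span ℂ ((fun m i l => ((m i l : ℚ) : ℂ)) '' (K : Set (Fin (r + 1) → Fin d → ℚ)))

/-- The algebraic subset of `(ℂ^d)^{r+1}` defined by an ideal. -/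
def tupleZeroLocus {d r : ℕ} (I : Ideal (MvPolynomial (Fin (r + 1) × Fin d) ℂ)) :
    Set (Fin (r + 1) → Fin d → ℂ) :=
  {m | (fun q : Fin (r + 1) × Fin d => m q.1 q.2) ∈ MvPolynomial.zeroLocus ℂ I}

end CayleyContact

end

/-!
The equations of the hyperplanes tangent to `X_A` at the unit element are the affine relations
between the points of `A`, and they form a linear space `L` defined over `ℚ`. The map
`a ↦ (m_0, …, m_r)` sends `L` onto `K_ℂ`, because every tuple in `⨁ V_i` comes from coefficients
with zero sum on each `A_i`; this gives (i) and (ii).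

Translating by a torus element multiplies coefficient vectors by its characters. Along the subtorus
`{1} × (ℂ^×)^r` the characters are constant on each block, `s_i` on the block of `A_i`, with
`s_0 = 1`, so tangency at `s` means `∑ s_i m_i = 0`. These linear equations in `s` have rank `α` for
generic `m ∈ K_ℂ`, hence the contact locus has dimension `r - α`.

For the dual defect, parametrize the conormal vectors at points of the torus as
`(i, u) ↦ χ(u) s_i a_{i,u}` with `a ∈ L`, where `χ` is a character of the lattice `Λ` spanned by all
the `A_i - A_i`. Generically `s` can be changed modulo the relations `∑ s_i m_i = 0` at the cost of
another `a ∈ L`, so only `α` of the parameters `s_i` are needed and the cone over `X_A^*` has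
dimension at most `rank Λ + α + dim L`, while `dim L ≤ #A - (r + 1) - rank Λ`.

In (iv), integral relations give `z_i ∈ ⟨A_i - A_i⟩` with `∑ z_i = 0`, so `p z_i = 0` by the join
property: all `m_i` lie in the kernel of `p_ℚ`, which has dimension `c`.
-/

noncomputable section

namespace CayleyContact

open MvPolynomial
open scoped Matrix

/-! ### Polynomials restricted to linear subspaces -/

section LinearPullback

variable {R ι κ : Type*} [CommRing R] [Fintype κ] [DecidableEq κ]

/-- The algebra homomorphism `F ↦ F ∘ φ` for a linear map `φ` between coordinate spaces. -/
def linearPullback (φ : (κ → R) →ₗ[R] (ι → R)) : MvPolynomial ι R →ₐ[R] MvPolynomial κ R :=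
  aeval φ.toMatrix'.toMvPolynomial

@[simp]
theorem eval_linearPullback (φ : (κ → R) →ₗ[R] (ι → R)) (F : MvPolynomial ι R) (x : κ → R) :
    eval x (linearPullback φ F) = eval (φ x) F := by
  have hcoord : (fun i => eval x (φ.toMatrix'.toMvPolynomial i)) = φ x := by
    ext i
    rw [Matrix.toMvPolynomial_eval_eq_apply, LinearMap.toMatrix'_mulVec]
  rw [linearPullback, ← hcoord]
  exact eval₂Hom_bind₁ _ _ _ _

theorem linearPullback_surjective [IsDomain R] [Infinite R] [Finite ι]
    {φ : (κ → R) →ₗ[R] (ι → R)} {ψ : (ι → R) →ₗ[R] (κ → R)}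
    (h : Function.LeftInverse ψ φ) : Function.Surjective (linearPullback φ) := by
  classical
  have := Fintype.ofFinite ι
  exact fun F => ⟨linearPullback ψ F, MvPolynomial.funext fun x => by
    rw [eval_linearPullback, eval_linearPullback, h x]⟩

end LinearPullback

section Density

variable {R V ι κ : Type*} [CommRing R] [IsDomain R] [Infinite R] [AddCommGroup V] [Module R V]

theorem eval_map_eq_zero_of_generic [Module.Finite R V] [Module.Free R V]
    (φ : V →ₗ[R] (ι → R)) (ψ : V →ₗ[R] (κ → R)) {F : MvPolynomial ι R} {G : MvPolynomial κ R}
    {v₀ : V} (hG : eval (ψ v₀) G ≠ 0) (h : ∀ v, eval (ψ v) G ≠ 0 → eval (φ v) F = 0) (v : V) :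
    eval (φ v) F = 0 := by
  let b := (Module.Free.chooseBasis R V).equivFun
  let F' := linearPullback (φ ∘ₗ b.symm.toLinearMap) F
  let G' := linearPullback (ψ ∘ₗ b.symm.toLinearMap) G
  have hF' (w : V) : eval (b w) F' = eval (φ w) F := by simp [F']
  have hG' (w : V) : eval (b w) G' = eval (ψ w) G := by simp [G']
  have hmul : G' * F' = 0 := MvPolynomial.funext fun x => by
    obtain ⟨w, rfl⟩ := b.surjective x
    rw [map_mul, hF', hG', map_zero, mul_eq_zero, or_iff_not_imp_left]
    exact h w
  have hG'0 : G' ≠ 0 := by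
    rintro h0
    exact hG (by rw [← hG', h0, map_zero])
  rw [← hF', (mul_eq_zero.1 hmul).resolve_left hG'0, map_zero]

omit [Infinite R] in
theorem eval_map_eq_zero_of_mem_span {k : Type*} [CommRing k] [Infinite k] [Algebra k R]
    [FaithfulSMul k R] [Module k V] [IsScalarTower k R V] (S : Submodule k V)
    (φ : V →ₗ[R] (ι → R)) {F : MvPolynomial ι R} (h : ∀ v ∈ S, eval (φ v) F = 0) {v : V}
    (hv : v ∈ Submodule.span R (S : Set V)) : eval (φ v) F = 0 := by
  obtain ⟨n, c, x, rfl⟩ := Submodule.mem_span_set'.1 hv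
  let ψ := Fintype.linearCombination R fun j => (x j : V)
  have hF : linearPullback (φ ∘ₗ ψ) F = 0 := by
    refine funext_set (fun _ => Set.range (algebraMap k R))
      (fun _ => Set.infinite_range_of_injective (FaithfulSMul.algebraMap_injective k R))
      fun y hy => ?_
    choose q hq using fun j => hy j (Set.mem_univ j)
    rw [eval_linearPullback, map_zero]
    refine h _ ?_
    simp only [ψ, Fintype.linearCombination_apply, ← hq, algebraMap_smul]
    exact S.sum_mem fun j _ => S.smul_mem _ (x j).2
  have := congrArg (eval c) hF
  rwa [eval_linearPullback, map_zero] at this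

end Density

/-! ### Solutions of linear systems under flat base change -/

theorem ker_mulVecLin_map_algebraMap {R S m n : Type*} [CommRing R] [CommRing S] [Algebra R S]
    [Module.Flat R S] [Finite m] [Fintype n] (M : Matrix m n R) :
    LinearMap.ker (M.map (algebraMap R S)).mulVecLin =
      Submodule.span S
        ((fun x => algebraMap R S ∘ x) '' (LinearMap.ker M.mulVecLin : Set (n → R))) := by
  classical
  have := Fintype.ofFinite m
  apply le_antisymm
  · intro a ha
    have hcomp : Fintype.linearCombination R a ∘ₗ M.vecMulLinear = 0 := by
      refine LinearMap.pi_ext' fun i => LinearMap.ext_ring ?_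
      simpa [Fintype.linearCombination_apply, Algebra.smul_def, Matrix.mulVec, dotProduct]
        using congrFun (LinearMap.mem_ker.1 ha) i
    obtain ⟨k, N, y, hy, hN⟩ := Module.Flat.exists_factorization_of_comp_eq_zero_of_free hcomp
    let P := ((Finsupp.linearEquivFunOnFinite R R (Fin k)).toLinearMap ∘ₗ N).toMatrix'
    have hP (x : n → R) : P *ᵥ x = N x := by
      rw [LinearMap.toMatrix'_mulVec]
      rfl
    have ha_eq : a = ∑ l, y (.single l 1) • (algebraMap R S ∘ P l) := by
      ext j
      have hj : a j = y (N (Pi.single j 1)) := by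
        rw [← LinearMap.comp_apply, ← hy, Fintype.linearCombination_apply_single, one_smul]
      rw [hj, ← (N (Pi.single j 1)).sum_single, Finsupp.sum_fintype _ _ (by simp), map_sum,
        ← hP, Finset.sum_apply]
      refine Finset.sum_congr rfl fun l _ => ?_
      rw [Matrix.mulVec_single_one, ← Finsupp.smul_single_one, map_smul, Algebra.smul_def, mul_comm]
      rfl
    rw [ha_eq]
    refine Submodule.sum_mem _ fun l _ =>
      Submodule.smul_mem _ _ (Submodule.subset_span ⟨_, LinearMap.mem_ker.2 ?_, rfl⟩)
    ext i
    have hi := congrFun (hP (Pi.single i 1 ᵥ* M)) l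
    rw [← Matrix.vecMulLinear_apply, ← LinearMap.comp_apply, hN, Matrix.vecMulLinear_apply,
      Matrix.single_one_vecMul] at hi
    exact (dotProduct_comm _ _).trans hi
  · rw [Submodule.span_le]
    rintro _ ⟨x, hx, rfl⟩
    ext i
    simpa [RingHom.map_mulVec] using congrArg (algebraMap R S) (congrFun (LinearMap.mem_ker.1 hx) i)

/-! ### Krull dimensions -/

theorem ringKrullDim_le_of_isIntegral {R S : Type*} [CommRing R] [CommRing S] (g : R →+* S)
    (hg : g.IsIntegral) : ringKrullDim S ≤ ringKrullDim R := by
  algebraize [g]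
  have : Algebra.IsIntegral R S := ⟨hg⟩
  exact Order.krullDim_le_of_strictMono (PrimeSpectrum.comap g) fun p q hpq =>
    Ideal.IsIntegral.comap_lt_comap (R := R) (show p.asIdeal < q.asIdeal from hpq)

theorem ringKrullDim_quotient_ker_le_card {k ι τ : Type*} [Field k] [Finite ι] [Fintype τ]
    (f : MvPolynomial ι k →ₐ[k] MvPolynomial τ k) :
    ringKrullDim (MvPolynomial ι k ⧸ RingHom.ker f) ≤ Fintype.card τ := by
  have : Nontrivial (MvPolynomial ι k ⧸ RingHom.ker f) :=
    Ideal.Quotient.nontrivial_iff.2 (RingHom.ker_ne_top f)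
  obtain ⟨s, g, hinj, hint⟩ :=
    exists_integral_inj_algHom_of_fg k (MvPolynomial ι k ⧸ RingHom.ker f)
  have hdim := ringKrullDim_le_of_isIntegral g.toRingHom hint
  rw [MvPolynomial.ringKrullDim_of_isNoetherianRing, ringKrullDim_eq_zero_of_field] at hdim
  have htrdeg := lift_trdeg_le_of_injective ((Ideal.kerLiftAlg f).comp g)
    ((Ideal.kerLiftAlg_injective f).comp hinj)
  rw [MvPolynomial.trdeg_of_isDomain, MvPolynomial.trdeg_of_isDomain] at htrdeg
  refine hdim.trans ?_
  simpa using htrdeg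

theorem ringKrullDim_quotient_vanishingIdeal_submodule {k ι : Type*} [Field k] [Infinite k]
    [Finite ι] (W : Submodule k (ι → k)) :
    ringKrullDim (MvPolynomial ι k ⧸ vanishingIdeal k (W : Set (ι → k))) =
      Module.finrank k W := by
  classical
  let e := (Module.finBasis k W).equivFun
  let φ := W.subtype ∘ₗ e.symm.toLinearMap
  have hφ : LinearMap.ker φ = ⊥ := by
    rw [LinearMap.ker_eq_bot]
    exact W.subtype_injective.comp e.symm.injective
  obtain ⟨ψ, hψ⟩ := LinearMap.exists_leftInverse_of_injective φ hφ
  have hsurj := linearPullback_surjective (LinearMap.congr_fun hψ)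
  have hker : vanishingIdeal k (W : Set (ι → k)) = RingHom.ker (linearPullback φ) := by
    ext F
    rw [RingHom.mem_ker, MvPolynomial.funext_iff, mem_vanishingIdeal_iff]
    simp only [eval_linearPullback, map_zero]
    exact ⟨fun h x => h _ (e.symm x).2, fun h w hw => by simpa [φ] using h (e ⟨w, hw⟩)⟩
  rw [hker, ringKrullDim_eq_of_ringEquiv
    (Ideal.quotientKerAlgEquivOfSurjective hsurj).toRingEquiv,
    MvPolynomial.ringKrullDim_of_isNoetherianRing, ringKrullDim_eq_zero_of_field]
  simp

/-! ### Closures and general points in projective space -/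

section Rescale

variable {R ι : Type*} [CommSemiring R]

/-- The algebra homomorphism `F ↦ F(cX)`, through which the homogeneity of `idealOf` enters. -/
def rescale (c : R) : MvPolynomial ι R →ₐ[R] MvPolynomial ι R :=
  aeval fun i => C c * X i

theorem eval_rescale (c : R) (F : MvPolynomial ι R) (v : ι → R) :
    eval v (rescale c F) = eval (c • v) F := by
  refine (eval₂Hom_bind₁ _ _ _ _).trans ?_
  congr 2
  ext i
  simp

theorem pderiv_rescale (c : R) (F : MvPolynomial ι R) (i : ι) :
    pderiv i (rescale c F) = C c * rescale c (pderiv i F) := by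
  classical
  induction F using MvPolynomial.induction_on with
  | C a => simp [rescale]
  | add p q hp hq => simp only [map_add, hp, hq, mul_add]
  | mul_X p j hp =>
    rw [map_mul, Derivation.leibniz, Derivation.leibniz, hp]
    rcases eq_or_ne j i with rfl | hji
    · simp [rescale]
      ring
    · simp [rescale, hji, Derivation.leibniz]
      ring

end Rescale

section ProjSpace

variable {ι : Type} {S T : Set (ProjSpace ι)} {F : MvPolynomial ι ℂ}

theorem mem_idealOf : F ∈ idealOf S ↔ ∀ v ∈ affineCone S, eval v F = 0 := Iff.rfl

theorem mem_zariskiClosure {P : ProjSpace ι} :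
    P ∈ zariskiClosure S ↔ ∀ F ∈ idealOf S, eval P.rep F = 0 := Iff.rfl

theorem zero_mem_affineCone : (0 : ι → ℂ) ∈ affineCone S := fun h => absurd rfl h

theorem mk_smul_eq_mk {v : ι → ℂ} (hv : v ≠ 0) {c : ℂ} (hcv : c • v ≠ 0) :
    Projectivization.mk ℂ (c • v) hcv = Projectivization.mk ℂ v hv :=
  (Projectivization.mk_eq_mk_iff' ℂ _ _ _ _).2 ⟨c, rfl⟩

theorem smul_mem_affineCone {v : ι → ℂ} (hv : v ∈ affineCone S) (c : ℂ) :
    c • v ∈ affineCone S := fun h => by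
  have hv0 : v ≠ 0 := by
    rintro rfl
    exact h (smul_zero c)
  rw [mk_smul_eq_mk hv0]
  exact hv hv0

theorem rep_mem_affineCone {P : ProjSpace ι} (hP : P ∈ S) : P.rep ∈ affineCone S :=
  fun _ => by rwa [Projectivization.mk_rep]

theorem subset_zariskiClosure (S : Set (ProjSpace ι)) : S ⊆ zariskiClosure S :=
  fun _ hP _ hF => hF _ (rep_mem_affineCone hP)

theorem rescale_mem_idealOf (hF : F ∈ idealOf S) (c : ℂ) : rescale c F ∈ idealOf S :=
  mem_idealOf.2 fun v hv => by
    rw [eval_rescale]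
    exact hF _ (smul_mem_affineCone hv c)

theorem idealOf_zariskiClosure (S : Set (ProjSpace ι)) :
    idealOf (zariskiClosure S) = idealOf S := by
  refine le_antisymm (vanishingIdeal_anti_mono fun v hv h => subset_zariskiClosure S (hv h))
    fun F hF => mem_idealOf.2 fun v hv => ?_
  by_cases hv0 : v = 0
  · rw [hv0]
    exact hF _ zero_mem_affineCone
  · obtain ⟨c, hc⟩ := Projectivization.exists_smul_eq_mk_rep ℂ v hv0
    have hrep := mem_zariskiClosure.1 (hv hv0) _ (rescale_mem_idealOf hF (c⁻¹ : ℂˣ))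
    rwa [eval_rescale, ← hc, ← Units.smul_def, inv_smul_smul] at hrep

theorem coneDim_zariskiClosure (S : Set (ProjSpace ι)) :
    coneDim (zariskiClosure S) = coneDim S := by
  rw [coneDim, coneDim, idealOf_zariskiClosure]

/-- The points of projective space along whose line a (not necessarily homogeneous) polynomial
vanishes; it makes an algebraic set out of a condition on coefficient vectors. -/
def lineZeroLocus (F : MvPolynomial ι ℂ) : Set (ProjSpace ι) :=
  {P | ∀ c : ℂ, eval (c • P.rep) F = 0}

theorem mk_mem_lineZeroLocus {v : ι → ℂ} (hv : v ≠ 0) :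
    Projectivization.mk ℂ v hv ∈ lineZeroLocus F ↔ ∀ c : ℂ, eval (c • v) F = 0 := by
  obtain ⟨a, ha⟩ := Projectivization.exists_smul_eq_mk_rep ℂ v hv
  rw [lineZeroLocus, Set.mem_ofPred_eq, ← ha]
  refine ⟨fun h c => ?_, fun h c => ?_⟩
  · simpa [Units.smul_def, smul_smul] using h (c * (a⁻¹ : ℂˣ))
  · simpa [Units.smul_def, smul_smul] using h (c * a)

theorem isAlgebraicSet_lineZeroLocus (F : MvPolynomial ι ℂ) :
    IsAlgebraicSet (lineZeroLocus F) := by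
  refine subset_antisymm (fun P hP c => ?_) (subset_zariskiClosure _)
  obtain ⟨i, hi⟩ := Function.ne_iff.1 P.rep_nonzero
  -- The factor `X i` makes the equation `F(cX) = 0` hold at the cone point `0` as well.
  have hmem : MvPolynomial.X i * rescale c F ∈ idealOf (lineZeroLocus F) :=
    mem_idealOf.2 fun v hv => by
      by_cases hv0 : v = 0
      · simp [hv0]
      · rw [map_mul, eval_rescale, (mk_mem_lineZeroLocus hv0).1 (hv hv0) c, mul_zero]
  have hzero := mem_zariskiClosure.1 hP _ hmem
  rw [map_mul, eval_rescale, eval_X] at hzero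
  exact (mul_eq_zero.1 hzero).resolve_left hi

theorem holdsGenerally_of_eval_ne_zero {a : ι → ℂ} (ha : a ∈ affineCone T) (hF : eval a F ≠ 0) :
    HoldsGenerally T fun H =>
      ∃ (b : ι → ℂ) (hb : b ≠ 0), Projectivization.mk ℂ b hb = H ∧ eval b F ≠ 0 := by
  refine ⟨lineZeroLocus F, isAlgebraicSet_lineZeroLocus F, fun ⟨H, hH⟩ hsub => hF ?_,
    fun H _ hHF => ?_⟩
  · by_cases ha0 : a = 0
    · simpa [ha0] using hsub hH 0
    · simpa using (mk_mem_lineZeroLocus ha0).1 (hsub (ha ha0)) 1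
  · obtain ⟨c, hc, hcF⟩ : ∃ c : ℂ, c ≠ 0 ∧ eval (c • H.rep) F ≠ 0 := by
      by_contra! hvanish
      refine hHF fun c => eval_map_eq_zero_of_generic (LinearMap.toSpanSingleton ℂ _ H.rep)
        (LinearMap.pi fun _ : Unit => LinearMap.id) (G := X ()) (v₀ := 1) (by simp) ?_ c
      simpa using hvanish
    have hcH : c • H.rep ≠ 0 := smul_ne_zero hc H.rep_nonzero
    exact ⟨c • H.rep, hcH, by rw [mk_smul_eq_mk H.rep_nonzero, Projectivization.mk_rep], hcF⟩

end ProjSpace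

section ConeDim

variable {ι : Type} [Finite ι] {S : Set (ProjSpace ι)}

theorem coneDim_eq_finrank {W : Submodule ℂ (ι → ℂ)}
    (h : ∀ F, F ∈ idealOf S ↔ ∀ w ∈ W, eval w F = 0) : coneDim S = Module.finrank ℂ W := by
  have hI : idealOf S = vanishingIdeal ℂ (W : Set (ι → ℂ)) := Ideal.ext h
  have hdim := coe_coneDim S
  rw [hI, ringKrullDim_quotient_vanishingIdeal_submodule] at hdim
  exact_mod_cast hdim

theorem coneDim_le_card {τ : Type*} [Fintype τ] (f : MvPolynomial ι ℂ →ₐ[ℂ] MvPolynomial τ ℂ)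
    (h : RingHom.ker f ≤ idealOf S) : coneDim S ≤ Fintype.card τ := by
  have hdim := (ringKrullDim_le_of_surjective _ (Ideal.Quotient.factor_surjective h)).trans
    (ringKrullDim_quotient_ker_le_card f)
  rw [← coe_coneDim] at hdim
  exact_mod_cast hdim

end ConeDim

/-! ### Gradients and conormal spaces -/

section Gradient

variable {ι R : Type*}

/-- The gradient of a polynomial at `p`, as a linear map. -/
def gradientAt [CommSemiring R] (p : ι → R) : MvPolynomial ι R →ₗ[R] (ι → R) :=
  LinearMap.pi fun i => (aeval p).toLinearMap ∘ₗ (pderiv i).toLinearMap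

@[simp]
theorem gradientAt_apply [CommSemiring R] (p : ι → R) (F : MvPolynomial ι R) (i : ι) :
    gradientAt p F i = eval p (pderiv i F) := by
  simp [gradientAt, aeval_eq_eval]

theorem gradientAt_rescale [CommSemiring R] (c : R) (p : ι → R) (F : MvPolynomial ι R) :
    gradientAt p (rescale c F) = c • gradientAt (c • p) F := by
  ext i
  simp [pderiv_rescale, eval_rescale]

theorem gradientAt_mul [CommSemiring R] (p : ι → R) (F G : MvPolynomial ι R) :
    gradientAt p (F * G) = eval p F • gradientAt p G + eval p G • gradientAt p F := by
  ext i
  simp [Derivation.leibniz]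

theorem gradientAt_X [CommSemiring R] [DecidableEq ι] (p : ι → R) (i : ι) :
    gradientAt p (X i) = Pi.single i 1 := by
  ext j
  rcases eq_or_ne i j with rfl | h
  · simp
  · simp [pderiv_X_of_ne h, h.symm]

theorem hasDerivAt_eval_comp {𝕜 : Type*} [NontriviallyNormedField 𝕜] [Fintype ι]
    (F : MvPolynomial ι 𝕜) {γ : 𝕜 → ι → 𝕜} {γ' : ι → 𝕜} {x : 𝕜} (hγ : HasDerivAt γ γ' x) :
    HasDerivAt (fun y => eval (γ y) F) (gradientAt (γ x) F ⬝ᵥ γ') x := by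
  classical
  induction F using MvPolynomial.induction_on with
  | C a => simpa [gradientAt, dotProduct] using hasDerivAt_const x a
  | add p q hp hq =>
    simp only [map_add, add_dotProduct]
    exact hp.add hq
  | mul_X p j hp =>
    simp only [map_mul, eval_X, gradientAt_mul, gradientAt_X, add_dotProduct, smul_dotProduct,
      single_dotProduct, smul_eq_mul, one_mul]
    convert! hp.mul (hasDerivAt_pi.1 hγ j) using 1
    ring

end Gradient

section Conormal

variable {ι : Type} {X Y : Set (ProjSpace ι)}

/-- The linear forms cutting out the embedded tangent space of `X` at the point with homogeneous
coordinates `p`: the gradients at `p` of the equations of `X`. -/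
def conormalSpace (X : Set (ProjSpace ι)) (p : ι → ℂ) : Submodule ℂ (ι → ℂ) :=
  ((idealOf X).restrictScalars ℂ).map (gradientAt p)

theorem conormalSpace_smul_le {c : ℂ} (hc : c ≠ 0) (p : ι → ℂ) :
    conormalSpace X (c • p) ≤ conormalSpace X p := by
  rintro _ ⟨F, hF, rfl⟩
  refine ((conormalSpace X p).smul_mem_iff hc).1 ?_
  rw [← gradientAt_rescale]
  exact Submodule.mem_map_of_mem (rescale_mem_idealOf hF c)

theorem conormalSpace_smul {c : ℂ} (hc : c ≠ 0) (p : ι → ℂ) :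
    conormalSpace X (c • p) = conormalSpace X p := by
  refine (conormalSpace_smul_le hc p).antisymm ?_
  simpa [smul_smul, hc] using conormalSpace_smul_le (X := X) (inv_ne_zero hc) (c • p)

theorem isTangentAt_iff_mem_conormalSpace [Fintype ι] {H P : ProjSpace ι} :
    IsTangentAt X H P ↔ H.rep ∈ conormalSpace X P.rep := by
  classical
  refine ⟨fun h => ?_, ?_⟩
  · by_contra hH
    obtain ⟨f, hfH, hf⟩ := Submodule.exists_le_ker_of_notMem hH
    have hf_apply := LinearMap.pi_apply_eq_sum_univ f
    refine hfH ((hf_apply _).trans (h _ fun F hF => ?_))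
    have hF0 : f (gradientAt P.rep F) = 0 := hf (Submodule.mem_map_of_mem hF)
    rw [hf_apply] at hF0
    simpa only [gradientAt_apply, smul_eq_mul] using hF0
  · rintro ⟨F, hF, hFH⟩ v hv
    simpa [← hFH] using hv F hF

theorem isTangentAt_mk_mk [Fintype ι] {a p : ι → ℂ} (ha : a ≠ 0) (hp : p ≠ 0) :
    IsTangentAt X (Projectivization.mk ℂ a ha) (Projectivization.mk ℂ p hp) ↔
      a ∈ conormalSpace X p := by
  obtain ⟨c, hc⟩ := Projectivization.exists_smul_eq_mk_rep ℂ a ha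
  obtain ⟨e, he⟩ := Projectivization.exists_smul_eq_mk_rep ℂ p hp
  rw [isTangentAt_iff_mem_conormalSpace, ← hc, ← he, Units.smul_def, Units.smul_def,
    conormalSpace_smul e.ne_zero, Submodule.smul_mem_iff _ c.ne_zero]

theorem eval_eq_zero_of_mem_conormalSpace {G : MvPolynomial ι ℂ}
    (hG : ∀ (p : ι → ℂ) (hp : p ≠ 0), Projectivization.mk ℂ p hp ∈ Y →
      ∀ a ∈ conormalSpace X p, eval a G = 0)
    {P : ProjSpace ι} (hP : P ∈ zariskiClosure Y) {a : ι → ℂ} (ha : a ∈ conormalSpace X P.rep) :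
    eval a G = 0 := by
  obtain ⟨F, hF, rfl⟩ := ha
  obtain ⟨i, hi⟩ := Function.ne_iff.1 P.rep_nonzero
  -- `p ↦ G(∇F(p))` is again a polynomial.
  have hgrad (p : ι → ℂ) : eval p (aeval (fun j => pderiv j F) G) = eval (gradientAt p F) G := by
    refine (eval₂Hom_bind₁ _ _ _ _).trans ?_
    congr 2
  have hmem : MvPolynomial.X i * aeval (fun j => pderiv j F) G ∈ idealOf Y :=
    mem_idealOf.2 fun p hp => by
      by_cases hp0 : p = 0
      · simp [hp0]
      · rw [map_mul, hgrad, hG p hp0 (hp hp0) _ (Submodule.mem_map_of_mem hF), mul_zero]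
  have hzero := mem_zariskiClosure.1 hP _ hmem
  rw [map_mul, hgrad, eval_X] at hzero
  exact (mul_eq_zero.1 hzero).resolve_left hi

end Conormal

/-! ### Hyperplanes tangent to a toric variety -/

theorem zpow_sum {G κ : Type*} [CommGroup G] (g : G) (s : Finset κ) (c : κ → ℤ) :
    g ^ ∑ k ∈ s, c k = ∏ k ∈ s, g ^ c k := by
  classical
  induction s using Finset.induction_on with
  | empty => simp
  | insert k s hk ih => rw [Finset.sum_insert hk, Finset.prod_insert hk, zpow_add, ih]

section ToricTangency

variable {σ : Type} [Fintype σ]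

/-- The character `t ↦ t^v` of a torus, evaluated at `t`. -/
def torusChar (t : σ → ℂˣ) (v : σ → ℤ) : ℂˣ := ∏ l, t l ^ v l

theorem torusChar_add (t : σ → ℂˣ) (v w : σ → ℤ) :
    torusChar t (v + w) = torusChar t v * torusChar t w := by
  simp [torusChar, zpow_add, Finset.prod_mul_distrib]

theorem torusChar_sum_smul {κ : Type*} [Fintype κ] (t : σ → ℂˣ) (c : κ → ℤ) (v : κ → σ → ℤ) :
    torusChar t (∑ k, c k • v k) = ∏ k, torusChar t (v k) ^ c k := by
  simp only [torusChar, Finset.sum_apply, Pi.smul_apply, smul_eq_mul, zpow_sum, ← Finset.prod_zpow]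
  rw [Finset.prod_comm]
  simp only [← zpow_mul, mul_comm]

/-- The matrix whose columns are the points of `B` (entries in `R`), with a row of ones on top,
so that its kernel consists of the affine relations between the points of `B`. -/
def exponentMatrix (R : Type*) [Ring R] (B : Finset (σ → ℤ)) : Matrix (Option σ) B R :=
  Matrix.of fun o u => o.elim 1 fun l => ((u : σ → ℤ) l : R)

omit [Fintype σ] in
theorem exponentMatrix_map (k : Type*) {R : Type*} [CommRing k] [CommRing R] [Algebra k R]
    (B : Finset (σ → ℤ)) : (exponentMatrix k B).map (algebraMap k R) = exponentMatrix R B := by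
  ext (_ | l) u <;> simp [exponentMatrix]

variable {B : Finset (σ → ℤ)} {hB : B.Nonempty}

theorem mem_idealOf_toricVariety {F : MvPolynomial B ℂ} :
    F ∈ idealOf (toricVariety B hB) ↔ ∀ (c : ℂ) t, eval (c • monomialVec B t) F = 0 := by
  rw [toricVariety, idealOf_zariskiClosure, mem_idealOf]
  refine ⟨fun h c t => h _ (smul_mem_affineCone (fun _ => Set.mem_range_self t) c),
    fun h v hv => ?_⟩
  by_cases hv0 : v = 0
  · simpa [hv0] using h 0 1
  · obtain ⟨t, ht⟩ := hv hv0
    obtain ⟨c, rfl⟩ := (Projectivization.mk_eq_mk_iff' ℂ _ _ hv0 (monomialVec_ne_zero hB t)).1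
      ht.symm
    exact h c t

theorem gradientAt_dotProduct_eq_zero {F : MvPolynomial B ℂ}
    (hF : F ∈ idealOf (toricVariety B hB)) (t : σ → ℂˣ) (μ : Option σ → ℂ) :
    gradientAt (monomialVec B t) F ⬝ᵥ (monomialVec B t * (μ ᵥ* exponentMatrix ℂ B)) = 0 := by
  let e := μ ᵥ* exponentMatrix ℂ B
  -- A curve through `monomialVec B t` in the cone over the torus orbit.
  let γ (y : ℂ) : B → ℂ := fun u => monomialVec B t u * Complex.exp (y * e u)
  have he (u : B) : e u = μ none + ∑ l, μ (some l) * ((u : σ → ℤ) l : ℂ) := by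
    simp [e, Matrix.vecMul, dotProduct, exponentMatrix]
  have hcone (y : ℂ) : γ y = Complex.exp (y * μ none) •
      monomialVec B (fun l => t l * Units.mk0 _ (Complex.exp_ne_zero (y * μ (some l)))) := by
    ext u
    simp only [γ, he, mul_add, Finset.mul_sum, Complex.exp_add, Complex.exp_sum, monomialVec,
      mul_zpow, Finset.prod_mul_distrib, Pi.smul_apply, smul_eq_mul, Units.val_mul,
      Units.coe_prod, Units.val_zpow_eq_zpow_val, Units.val_mk0, ← Complex.exp_int_mul]
    rw [mul_left_comm]
    refine congrArg₂ _ rfl (congrArg₂ _ rfl (Finset.prod_congr rfl fun l _ => ?_))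
    ring_nf
  have hγ : HasDerivAt γ (monomialVec B t * e) 0 := hasDerivAt_pi.2 fun u => by
    simpa using (((hasDerivAt_id (0 : ℂ)).mul_const (e u)).cexp).const_mul (monomialVec B t u)
  have hγ0 : γ 0 = monomialVec B t := by
    ext u
    simp [γ]
  have hderiv := hasDerivAt_eval_comp F hγ
  rw [hγ0] at hderiv
  refine hderiv.unique ((hasDerivAt_const (0 : ℂ) (0 : ℂ)).congr_of_eventuallyEq
    (.of_forall fun y => ?_))
  simpa only [hcone] using mem_idealOf_toricVariety.1 hF _ _

/-- The binomial `X^{c⁺} - X^{c⁻}` of an integer vector `c`. -/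
def binomial {ι : Type*} [Fintype ι] (c : ι → ℤ) : MvPolynomial ι ℂ :=
  monomial (Finsupp.equivFunOnFinite.symm fun i => (c i).toNat) 1 -
    monomial (Finsupp.equivFunOnFinite.symm fun i => (-c i).toNat) 1

theorem eval_binomial {ι : Type*} [Fintype ι] (c : ι → ℤ) (p : ι → ℂ) :
    eval p (binomial c) = ∏ i, p i ^ (c i).toNat - ∏ i, p i ^ (-c i).toNat := by
  simp [binomial, eval_monomial, Finsupp.prod_fintype]

theorem mul_gradientAt_monomial {ι R : Type*} [CommSemiring R] (s : ι →₀ ℕ) (p : ι → R) :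
    p * gradientAt p (monomial s 1) = (s.prod fun i k => p i ^ k) • fun i => (s i : R) := by
  ext i
  have h := congrArg (eval p) (X_mul_pderiv_monomial (R := R) (i := i) (m := s) (r := 1))
  simpa [eval_monomial, mul_comm] using h

theorem prod_pow_toNat_eq {ι : Type*} [Fintype ι] {c : ι → ℤ} {q : ι → ℂˣ}
    (h : ∏ i, q i ^ c i = 1) : ∏ i, q i ^ (c i).toNat = ∏ i, q i ^ (-c i).toNat := by
  rw [← mul_inv_eq_one, ← Finset.prod_inv_distrib, ← Finset.prod_mul_distrib, ← h]
  refine Finset.prod_congr rfl fun i _ => ?_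
  rw [← zpow_natCast, ← zpow_natCast, ← zpow_neg, ← zpow_add, ← sub_eq_add_neg,
    Int.toNat_sub_toNat_neg]

theorem sum_toNat_eq {ι : Type*} [Fintype ι] {c : ι → ℤ} (h : ∑ i, c i = 0) :
    ∑ i, (c i).toNat = ∑ i, (-c i).toNat := by
  zify
  rw [← sub_eq_zero, ← Finset.sum_sub_distrib, ← h]
  exact Finset.sum_congr rfl fun i _ => Int.toNat_sub_toNat_neg (c i)

omit [Fintype σ] in
theorem mem_ker_exponentMatrix {R : Type*} [CommRing R] {c : B → R} :
    c ∈ LinearMap.ker (exponentMatrix R B).mulVecLin ↔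
      ∑ u, c u = 0 ∧ ∀ l, ∑ u : B, c u * ((u : σ → ℤ) l : R) = 0 := by
  simp [LinearMap.mem_ker, funext_iff, Option.forall, Matrix.mulVec, dotProduct, exponentMatrix,
    mul_comm]

theorem prod_monomialVec_toNat_eq {c : B → ℤ}
    (hc : c ∈ LinearMap.ker (exponentMatrix ℤ B).mulVecLin) (t : σ → ℂˣ) :
    ∏ u, monomialVec B t u ^ (c u).toNat = ∏ u, monomialVec B t u ^ (-c u).toNat := by
  have hsum : ∑ u : B, c u • (u : σ → ℤ) = 0 := by
    ext l
    simpa using (mem_ker_exponentMatrix.1 hc).2 l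
  have hchar := torusChar_sum_smul t c fun u => (u : σ → ℤ)
  rw [hsum] at hchar
  have h := congrArg Units.val (prod_pow_toNat_eq (hchar.symm.trans (by simp [torusChar])))
  push_cast at h
  exact h

theorem binomial_mem_idealOf {c : B → ℤ}
    (hc : c ∈ LinearMap.ker (exponentMatrix ℤ B).mulVecLin) :
    binomial c ∈ idealOf (toricVariety B hB) :=
  mem_idealOf_toricVariety.2 fun x t => by
    simp only [eval_binomial, Pi.smul_apply, smul_eq_mul, mul_pow, Finset.prod_mul_distrib,
      Finset.prod_pow_eq_pow_sum, prod_monomialVec_toNat_eq hc,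
      sum_toNat_eq (mem_ker_exponentMatrix.1 hc).1, sub_self]

theorem exists_mem_conormalSpace_mul_eq {c : B → ℤ}
    (hc : c ∈ LinearMap.ker (exponentMatrix ℤ B).mulVecLin) (t : σ → ℂˣ) :
    ∃ b ∈ conormalSpace (toricVariety B hB) (monomialVec B t),
      monomialVec B t * b = fun u => (c u : ℂ) := by
  let q : ℂ := ∏ u, monomialVec B t u ^ (c u).toNat
  have hq : q ≠ 0 := Finset.prod_ne_zero_iff.2 fun u _ => pow_ne_zero _ (Units.ne_zero _)
  refine ⟨q⁻¹ • gradientAt (monomialVec B t) (binomial c),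
    Submodule.smul_mem _ _ (Submodule.mem_map_of_mem (binomial_mem_idealOf hc)), ?_⟩
  rw [mul_smul_comm, binomial, map_sub, mul_sub, mul_gradientAt_monomial, mul_gradientAt_monomial,
    Finsupp.prod_fintype _ _ (by simp), Finsupp.prod_fintype _ _ (by simp)]
  simp only [Finsupp.equivFunOnFinite_symm_apply_apply, ← prod_monomialVec_toNat_eq hc]
  rw [← smul_sub, inv_smul_smul₀ hq]
  ext u
  have h := congrArg (Int.cast : ℤ → ℂ) (Int.toNat_sub_toNat_neg (c u))
  rwa [Int.cast_sub, Int.cast_natCast, Int.cast_natCast] at h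

theorem mem_conormalSpace_toricVariety {t : σ → ℂˣ} {a : B → ℂ} :
    a ∈ conormalSpace (toricVariety B hB) (monomialVec B t) ↔
      a * monomialVec B t ∈ LinearMap.ker (exponentMatrix ℂ B).mulVecLin := by
  classical
  constructor
  · rintro ⟨F, hF, rfl⟩
    ext o
    have h := gradientAt_dotProduct_eq_zero hF t (Pi.single o 1)
    rw [Matrix.single_one_vecMul] at h
    refine Eq.trans ?_ h
    exact Finset.sum_congr rfl fun u _ => by
      simp only [Pi.mul_apply, Matrix.row]
      ring
  · intro ha
    rw [← exponentMatrix_map ℤ, ker_mulVecLin_map_algebraMap] at ha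
    have hle : Submodule.span ℂ ((fun c => algebraMap ℤ ℂ ∘ c) ''
        (LinearMap.ker (exponentMatrix ℤ B).mulVecLin : Set (B → ℤ))) ≤
        (conormalSpace (toricVariety B hB) (monomialVec B t)).map
          (LinearMap.mulLeft ℂ (monomialVec B t)) := by
      rw [Submodule.span_le]
      rintro _ ⟨c, hc, rfl⟩
      exact exists_mem_conormalSpace_mul_eq hc t
    obtain ⟨b, hb, hab⟩ := hle ha
    rw [LinearMap.mulLeft_apply, mul_comm a] at hab
    rwa [← funext fun u => mul_left_cancel₀ (Units.ne_zero _) (congrFun hab u)]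

theorem mem_openContactLocus_mk {a : B → ℂ} (ha : a ≠ 0) {t : σ → ℂˣ} :
    t ∈ openContactLocus B hB (Projectivization.mk ℂ a ha) ↔
      a * monomialVec B t ∈ LinearMap.ker (exponentMatrix ℂ B).mulVecLin :=
  (isTangentAt_mk_mk ha (monomialVec_ne_zero hB t)).trans mem_conormalSpace_toricVariety

theorem affineCone_tangentHyperplanesAtOne :
    affineCone (tangentHyperplanesAtOne B hB) =
      LinearMap.ker (exponentMatrix ℂ B).mulVecLin := by
  ext a
  by_cases ha : a = 0
  · simp [ha, zero_mem_affineCone]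
  · have hone : monomialVec B 1 = 1 := by
      ext u
      simp [monomialVec]
    have := mem_openContactLocus_mk (hB := hB) ha (t := 1)
    rw [hone, mul_one] at this
    exact ⟨fun h => this.1 (h ha), fun h _ => this.2 h⟩

end ToricTangency

/-! ### Relations between the points of a Cayley sum -/

theorem mem_vectorSpan_range_iff {R V ι : Type*} [Ring R] [AddCommGroup V] [Module R V]
    [Fintype ι] {p : ι → V} {v : V} :
    v ∈ vectorSpan R (Set.range p) ↔ ∃ c : ι → R, ∑ i, c i = 0 ∧ ∑ i, c i • p i = v := by
  rw [mem_vectorSpan_iff_eq_weightedVSub]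
  constructor
  · rintro ⟨s, c, hc, rfl⟩
    have hsum : ∑ i, (s : Set ι).indicator c i = 0 :=
      (Finset.sum_indicator_subset c s.subset_univ).trans hc
    refine ⟨(s : Set ι).indicator c, hsum, ?_⟩
    rw [← Finset.weightedVSub_eq_linear_combination _ hsum,
      ← Finset.weightedVSub_indicator_subset _ _ s.subset_univ]
  · rintro ⟨c, hc, rfl⟩
    exact ⟨Finset.univ, c, hc, (Finset.weightedVSub_eq_linear_combination _ hc).symm⟩

theorem diffSpan_eq_vectorSpan {d : ℕ} (B : Finset (Fin d → ℤ)) :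
    diffSpan B = vectorSpan ℚ (Set.range fun u : B => (Int.cast ∘ u : Fin d → ℚ)) := by
  rw [diffSpan, vectorSpan]
  congr 1
  ext w
  simp only [Set.mem_vsub, Set.exists_range_iff, Subtype.exists, exists_prop, vsub_eq_sub]
  refine exists_congr fun u => and_congr_right fun _ => exists_congr fun v =>
    and_congr_right fun _ => ?_
  rw [eq_comm]
  simp [funext_iff]

section Cayley

variable {d r : ℕ} (A : Fin (r + 1) → Finset (Fin d → ℤ))

/-- The point `(u, e_i)` as an element of the Cayley sum. -/
def cayleyMk (i : Fin (r + 1)) (u : A i) : cayleySum A :=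
  ⟨cayleyPoint i u, cayleyPoint_mem A i u⟩

theorem cayleyPoint_injective :
    Function.Injective fun q : Fin (r + 1) × (Fin d → ℤ) => cayleyPoint q.1 q.2 := by
  rintro ⟨i, u⟩ ⟨j, v⟩ h
  have hfib (l : Fin r) : i = l.succ ↔ j = l.succ := by
    have := congrFun h (Sum.inr l)
    simp only [cayleyPoint, Sum.elim_inr] at this
    split_ifs at this <;> simp_all
  refine Prod.ext ?_ (funext fun l => congrFun h (Sum.inl l))
  cases i using Fin.cases with
  | zero =>
    cases j using Fin.cases with
    | zero => rfl
    | succ l => exact (hfib l).2 rfl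
  | succ l => exact ((hfib l).1 rfl).symm

/-- A Cayley sum is the disjoint union of its summands. -/
def cayleyEquiv : (Σ i, A i) ≃ cayleySum A :=
  Equiv.ofBijective (fun q => cayleyMk A q.1 q.2) <| by
    constructor
    · rintro ⟨i, u, hu⟩ ⟨j, v, hv⟩ h
      obtain ⟨rfl, rfl⟩ := Prod.ext_iff.1 (cayleyPoint_injective (a₁ := (i, u)) (a₂ := (j, v))
        (congrArg Subtype.val h))
      rfl
    · rintro ⟨w, hw⟩
      obtain ⟨i, -, hi⟩ := Finset.mem_biUnion.1 hw
      obtain ⟨u, hu, rfl⟩ := Finset.mem_image.1 hi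
      exact ⟨⟨i, u, hu⟩, rfl⟩

/-- The index `i` of the block of a point `(u, e_i)`. -/
def blockIndex (w : cayleySum A) : Fin (r + 1) := ((cayleyEquiv A).symm w).1

@[simp]
theorem blockIndex_cayleyMk (i : Fin (r + 1)) (u : A i) : blockIndex A (cayleyMk A i u) = i :=
  congrArg Sigma.fst ((cayleyEquiv A).symm_apply_apply ⟨i, u⟩)

variable {A} in
theorem forall_cayleySum {p : cayleySum A → Prop} :
    (∀ w, p w) ↔ ∀ (i : Fin (r + 1)) (u : A i), p (cayleyMk A i u) :=
  (cayleyEquiv A).symm.forall_congr_left.trans Sigma.forall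

theorem sum_cayleySum {M : Type*} [AddCommMonoid M] (f : cayleySum A → M) :
    ∑ w, f w = ∑ i, ∑ u : A i, f (cayleyMk A i u) := by
  rw [← (cayleyEquiv A).sum_comp, Fintype.sum_sigma]
  rfl

variable (R : Type*) [CommRing R]

/-- The sums of the coefficients of a vector over the summands of a Cayley sum. -/
def blockSum : (cayleySum A → R) →ₗ[R] (Fin (r + 1) → R) :=
  LinearMap.pi fun i => ∑ u : A i, LinearMap.proj (cayleyMk A i u)

/-- The map `a ↦ (m_0, …, m_r)`, `m_i = ∑ u, a_{i,u} u`, over an arbitrary coefficient ring; over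
`ℂ` it is the function `moments`. -/
def blockMoments : (cayleySum A → R) →ₗ[R] (Fin (r + 1) → Fin d → R) :=
  LinearMap.pi fun i =>
    ∑ u : A i, (LinearMap.proj (cayleyMk A i u)).smulRight (Int.cast ∘ u : Fin d → R)

/-- The affine relations between the points of a Cayley sum; over `ℂ` these are the equations of
the hyperplanes tangent at the unit of the torus. -/
def cayleyRelations : Submodule R (cayleySum A → R) :=
  LinearMap.ker (exponentMatrix R (cayleySum A)).mulVecLin

variable {R}

theorem blockSum_apply (a : cayleySum A → R) (i : Fin (r + 1)) :
    blockSum A R a i = ∑ u : A i, a (cayleyMk A i u) := by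
  simp [blockSum]

theorem blockMoments_apply (a : cayleySum A → R) (i : Fin (r + 1)) :
    blockMoments A R a i = ∑ u : A i, a (cayleyMk A i u) • (Int.cast ∘ u : Fin d → R) := by
  simp [blockMoments]

theorem moments_eq_blockMoments (a : cayleySum A → ℂ) : moments A a = blockMoments A ℂ a := by
  ext i l
  simp [blockMoments_apply, moments, cayleyMk]

variable {A}

theorem mem_cayleyRelations {a : cayleySum A → R} :
    a ∈ cayleyRelations A R ↔ blockSum A R a = 0 ∧ ∑ i, blockMoments A R a i = 0 := by
  have hbase (l : Fin d) : ∑ w : cayleySum A, a w * ((w : Fin d ⊕ Fin r → ℤ) (Sum.inl l) : R) =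
      (∑ i, blockMoments A R a i) l := by
    rw [sum_cayleySum, Finset.sum_apply]
    simp [blockMoments_apply, cayleyMk, cayleyPoint]
  have hfib (k : Fin r) : ∑ w : cayleySum A, a w * ((w : Fin d ⊕ Fin r → ℤ) (Sum.inr k) : R) =
      blockSum A R a k.succ := by
    rw [sum_cayleySum, Finset.sum_eq_single_of_mem k.succ (Finset.mem_univ _)]
    · simp [blockSum_apply, cayleyMk, cayleyPoint]
    · intro i _ hi
      simp [cayleyMk, cayleyPoint, hi]
  have htotal : ∑ w, a w = blockSum A R a 0 + ∑ k : Fin r, blockSum A R a k.succ := by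
    rw [sum_cayleySum, Fin.sum_univ_succ]
    simp only [blockSum_apply]
  rw [cayleyRelations, mem_ker_exponentMatrix, Sum.forall, htotal, funext_iff, funext_iff,
    Fin.forall_fin_succ]
  simp only [hbase, hfib, Pi.zero_apply]
  constructor
  · rintro ⟨h0, hb, hf⟩
    simp only [hf, Finset.sum_const_zero, add_zero] at h0
    exact ⟨⟨h0, hf⟩, hb⟩
  · rintro ⟨⟨h0, hf⟩, hb⟩
    exact ⟨by simp only [h0, hf, Finset.sum_const_zero, add_zero], hb, hf⟩

theorem map_blockMoments_ker_blockSum :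
    (LinearMap.ker (blockSum A R)).map (blockMoments A R) =
      Submodule.pi Set.univ fun i =>
        vectorSpan R (Set.range fun u : A i => (Int.cast ∘ u : Fin d → R)) := by
  ext m
  simp only [Submodule.mem_map, Submodule.mem_pi, Set.mem_univ, true_imp_iff,
    mem_vectorSpan_range_iff, LinearMap.mem_ker]
  constructor
  · rintro ⟨a, ha, rfl⟩ i
    exact ⟨fun u => a (cayleyMk A i u), (blockSum_apply A a i).symm.trans (congrFun ha i),
      (blockMoments_apply A a i).symm⟩
  · intro h
    choose c hc hcm using h
    let a (w : cayleySum A) : R := (fun q : Σ i, A i => c q.1 q.2) ((cayleyEquiv A).symm w)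
    have ha (i : Fin (r + 1)) (u : A i) : a (cayleyMk A i u) = c i u :=
      congrArg (fun q : Σ i, A i => c q.1 q.2) ((cayleyEquiv A).symm_apply_apply ⟨i, u⟩)
    refine ⟨a, _root_.funext fun i => ?_, _root_.funext fun i => ?_⟩
    · simpa only [blockSum_apply, ha, Pi.zero_apply] using hc i
    · simpa only [blockMoments_apply, ha] using hcm i

theorem sumKernel_diffSpan_eq_map :
    (sumKernel fun i => diffSpan (A i)) = (cayleyRelations A ℚ).map (blockMoments A ℚ) := by
  ext m
  have hm : (∀ i, m i ∈ diffSpan (A i)) ↔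
      m ∈ (LinearMap.ker (blockSum A ℚ)).map (blockMoments A ℚ) := by
    simp [map_blockMoments_ker_blockSum, diffSpan_eq_vectorSpan]
  refine (and_congr_left' hm).trans ⟨?_, ?_⟩
  · rintro ⟨⟨a, ha, rfl⟩, hsum⟩
    exact ⟨a, mem_cayleyRelations.2 ⟨ha, hsum⟩, rfl⟩
  · rintro ⟨a, ha, rfl⟩
    rw [SetLike.mem_coe, mem_cayleyRelations] at ha
    exact ⟨⟨a, ha.1, rfl⟩, ha.2⟩

theorem cayleyRelations_eq_span (k : Type*) [CommRing k] [Algebra k R] [Module.Flat k R] :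
    cayleyRelations A R =
      Submodule.span R ((fun a => algebraMap k R ∘ a) '' (cayleyRelations A k : Set _)) := by
  rw [cayleyRelations, ← exponentMatrix_map k, ker_mulVecLin_map_algebraMap]
  rfl

theorem blockMoments_algebraMap {k : Type*} [CommRing k] [Algebra k R] (a : cayleySum A → k)
    (i : Fin (r + 1)) : blockMoments A R (algebraMap k R ∘ a) i =
      algebraMap k R ∘ blockMoments A k a i := by
  ext l
  simp [blockMoments_apply, Algebra.smul_def]

theorem complexifyTuple_sumKernel_eq_map :
    complexifyTuple (sumKernel fun i => diffSpan (A i)) =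
      (cayleyRelations A ℂ).map (blockMoments A ℂ) := by
  rw [cayleyRelations_eq_span ℚ, Submodule.map_span, sumKernel_diffSpan_eq_map, complexifyTuple,
    Submodule.map_coe, Set.image_image, Set.image_image]
  congr 2
  ext a i l
  simp [blockMoments_algebraMap]

theorem apply_mem_complexify {V : Fin (r + 1) → Submodule ℚ (Fin d → ℚ)}
    {m : Fin (r + 1) → Fin d → ℂ} (hm : m ∈ complexifyTuple (sumKernel V)) (i : Fin (r + 1)) :
    m i ∈ complexify (V i) := by
  have hle : complexifyTuple (sumKernel V) ≤ (complexify (V i)).comap (LinearMap.proj i) := by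
    refine Submodule.span_le.2 ?_
    rintro _ ⟨q, hq, rfl⟩
    exact Submodule.subset_span ⟨q i, hq.1 i, rfl⟩
  exact hle hm

end Cayley

/-! ### The generic rank of a tuple of vectors -/

section GenericRank

variable {k V ι κ : Type*} [Field k]

theorem exists_finset_card_eq_finrank_span [AddCommGroup V] [Module k V] [Finite ι] (m : ι → V) :
    ∃ J : Finset ι, J.card = Module.finrank k (Submodule.span k (Set.range m)) ∧
      LinearIndependent k fun j : J => m j := by
  obtain ⟨b, -, -, hspan, hli⟩ :=
    exists_linearIndepOn_extension (linearIndepOn_empty k m) (Set.subset_univ ∅)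
  have hb := b.toFinite.coe_toFinset
  refine ⟨b.toFinite.toFinset, ?_, ?_⟩
  · have hrange : Submodule.span k (Set.range m) =
        Submodule.span k (Set.range fun j : b => m j) := by
      rw [← Set.image_univ, ← Set.image_eq_range]
      exact le_antisymm (Submodule.span_le.2 hspan)
        (Submodule.span_mono (Set.image_mono b.subset_univ))
    have := Fintype.ofFinite b
    rw [hrange, finrank_span_eq_card hli, ← Nat.card_eq_fintype_card, Nat.card_coe_set_eq,
      Set.ncard_eq_toFinset_card _ b.toFinite]
  · rw [← hb] at hli
    exact hli

variable [Finite κ]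

theorem exists_polynomial_linearIndependent {J : Finset ι} {m : ι → κ → k}
    (hm : LinearIndependent k fun j : J => m j) :
    ∃ F : MvPolynomial (ι × κ) k, eval (Function.uncurry m) F ≠ 0 ∧
      ∀ m' : ι → κ → k, eval (Function.uncurry m') F ≠ 0 →
        LinearIndependent k fun j : J => m' j := by
  classical
  have := Fintype.ofFinite κ
  let rows (m' : ι → κ → k) : Matrix J κ k := Matrix.of fun j => m' j
  have hrange : LinearMap.range (rows m).mulVecLin = ⊤ :=
    Submodule.eq_top_of_finrank_eq <| by
      rw [Module.finrank_fintype_fun_eq_card]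
      exact LinearIndependent.rank_matrix hm
  obtain ⟨N, hN⟩ := Matrix.mulVec_surjective_iff_exists_right_inverse.1
    (LinearMap.range_eq_top.1 hrange)
  let F : MvPolynomial (ι × κ) k :=
    Matrix.det (Matrix.of fun i j : J => ∑ l, X ((i : ι), l) * C (N l j))
  have hF (m' : ι → κ → k) : eval (Function.uncurry m') F = (rows m' * N).det := by
    rw [RingHom.map_det]
    congr 1
    ext i j
    simp [Matrix.mul_apply, rows]
  refine ⟨F, by rw [hF, hN, Matrix.det_one]; exact one_ne_zero, fun m' h => ?_⟩
  rw [hF] at h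
  exact .of_comp N.vecMulLinear (Matrix.linearIndependent_rows_of_det_ne_zero h)

end GenericRank

section Alpha

variable {d r : ℕ} (V : Fin (r + 1) → Submodule ℚ (Fin d → ℚ))

theorem linearIndependent_ratCast {ι κ : Type*} [Finite κ] {m : ι → κ → ℚ} :
    LinearIndependent ℂ (fun i l => (m i l : ℂ)) ↔ LinearIndependent ℚ m := by
  simpa [Function.comp_def] using linearIndependent_algebraMap_comp_iff (S := ℂ) (v := m)

theorem bddAbove_finrank_sumKernel : BddAbove
    {s | ∃ m ∈ sumKernel V, s = Module.finrank ℚ (Submodule.span ℚ (Set.range m))} := by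
  refine ⟨Fintype.card (Fin (r + 1)), ?_⟩
  rintro _ ⟨m, -, rfl⟩
  exact finrank_range_le_card m

variable {V} in
theorem finrank_span_le_alphaInv {m : Fin (r + 1) → Fin d → ℂ}
    (hm : m ∈ complexifyTuple (sumKernel V)) :
    Module.finrank ℂ (Submodule.span ℂ (Set.range m)) ≤ alphaInv V := by
  obtain ⟨J, hJ, hli⟩ := exists_finset_card_eq_finrank_span (k := ℂ) m
  obtain ⟨F, hFm, hF⟩ := exists_polynomial_linearIndependent hli
  let toComplex : (Fin (r + 1) → Fin d → ℚ) →ₗ[ℚ] (Fin (r + 1) → Fin d → ℂ) :=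
    { toFun := fun q i l => (q i l : ℂ)
      map_add' := fun q q' => by ext i l; simp
      map_smul' := fun c q => by ext i l; simp [Rat.smul_def] }
  let e := (LinearEquiv.curry ℂ ℂ (Fin (r + 1)) (Fin d)).symm.toLinearMap
  -- The rational tuples are Zariski dense in their complex span.
  obtain ⟨q, hq, hFq⟩ : ∃ q ∈ sumKernel V,
      eval (Function.uncurry fun i l => (q i l : ℂ)) F ≠ 0 := by
    by_contra! h
    refine hFm (eval_map_eq_zero_of_mem_span ((sumKernel V).map toComplex) e ?_ hm)
    rintro _ ⟨q, hq, rfl⟩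
    exact h q hq
  have hqli : LinearIndependent ℚ fun j : J => q j :=
    (linearIndependent_ratCast (m := fun j : J => q j)).1 (hF (fun i l => (q i l : ℂ)) hFq)
  calc Module.finrank ℂ (Submodule.span ℂ (Set.range m))
      = Module.finrank ℚ (Submodule.span ℚ (Set.range fun j : J => q j)) := by
        rw [← hJ, finrank_span_eq_card hqli, Fintype.card_coe]
    _ ≤ Module.finrank ℚ (Submodule.span ℚ (Set.range q)) :=
        Submodule.finrank_mono (Submodule.span_mono (Set.range_comp_subset_range _ q))
    _ ≤ alphaInv V := le_csSup (bddAbove_finrank_sumKernel V) ⟨q, hq, rfl⟩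

theorem exists_generic_basis :
    ∃ (J : Finset (Fin (r + 1))) (F : MvPolynomial (Fin (r + 1) × Fin d) ℂ),
      J.card = alphaInv V ∧
      (∃ m ∈ complexifyTuple (sumKernel V), eval (Function.uncurry m) F ≠ 0) ∧
      ∀ m ∈ complexifyTuple (sumKernel V), eval (Function.uncurry m) F ≠ 0 →
        LinearIndependent ℂ (fun j : J => m j) ∧
        Submodule.span ℂ (Set.range fun j : J => m j) = Submodule.span ℂ (Set.range m) := by
  obtain ⟨q, hq, hα⟩ : ∃ q ∈ sumKernel V,
      alphaInv V = Module.finrank ℚ (Submodule.span ℚ (Set.range q)) :=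
    Nat.sSup_mem (s := {s | ∃ m ∈ sumKernel V,
      s = Module.finrank ℚ (Submodule.span ℚ (Set.range m))})
      ⟨_, 0, zero_mem _, rfl⟩ (bddAbove_finrank_sumKernel V)
  obtain ⟨J, hJ, hli⟩ := exists_finset_card_eq_finrank_span (k := ℚ) q
  have hcard : J.card = alphaInv V := hJ.trans hα.symm
  obtain ⟨F, hFq, hF⟩ := exists_polynomial_linearIndependent (m := fun i l => (q i l : ℂ))
    ((linearIndependent_ratCast (m := fun j : J => q j)).2 hli)
  refine ⟨J, F, hcard, ⟨_, Submodule.subset_span ⟨q, hq, rfl⟩, hFq⟩, fun m hm hFm => ?_⟩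
  have hmli := hF m hFm
  refine ⟨hmli, Submodule.eq_of_le_of_finrank_le
    (Submodule.span_mono (Set.range_comp_subset_range _ m)) ?_⟩
  rw [finrank_span_eq_card hmli, Fintype.card_coe, hcard]
  exact finrank_span_le_alphaInv hm

end Alpha

/-! ### Generic moments -/

section Generic

variable {d r : ℕ} {A : Fin (r + 1) → Finset (Fin d → ℤ)}

/-- The polynomial `F(m_0, …, m_r)` in the coefficients of a linear form, where the `m_i` are the
moments of the form. -/
def momentsPullback (F : MvPolynomial (Fin (r + 1) × Fin d) ℂ) : MvPolynomial (cayleySum A) ℂ :=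
  linearPullback ((LinearEquiv.curry ℂ ℂ _ _).symm.toLinearMap ∘ₗ blockMoments A ℂ) F

theorem eval_momentsPullback (F : MvPolynomial (Fin (r + 1) × Fin d) ℂ) (a : cayleySum A → ℂ) :
    eval a (momentsPullback F) = eval (Function.uncurry (moments A a)) F := by
  rw [momentsPullback, eval_linearPullback, moments_eq_blockMoments]
  rfl

theorem notMem_tupleZeroLocus {I : Ideal (MvPolynomial (Fin (r + 1) × Fin d) ℂ)}
    {m : Fin (r + 1) → Fin d → ℂ} :
    m ∉ tupleZeroLocus I ↔ ∃ F ∈ I, eval (Function.uncurry m) F ≠ 0 := by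
  rw [tupleZeroLocus, Set.mem_ofPred_eq, mem_zeroLocus_iff]
  push Not
  rfl

theorem mk_mem_tangentHyperplanesAtOne (hne : (cayleySum A).Nonempty) {a : cayleySum A → ℂ}
    (ha : a ≠ 0) : Projectivization.mk ℂ a ha ∈ tangentHyperplanesAtOne (cayleySum A) hne ↔
      a ∈ cayleyRelations A ℂ := by
  rw [cayleyRelations, ← SetLike.mem_coe, ← affineCone_tangentHyperplanesAtOne (hB := hne)]
  exact ⟨fun h _ => h, fun h => h ha⟩

theorem moments_mem_complexifyTuple {a : cayleySum A → ℂ} (ha : a ∈ cayleyRelations A ℂ) :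
    moments A a ∈ complexifyTuple (sumKernel fun i => diffSpan (A i)) := by
  rw [complexifyTuple_sumKernel_eq_map, moments_eq_blockMoments]
  exact Submodule.mem_map_of_mem ha

theorem HoldsGenerally.mono {ι : Type} {T : Set (ProjSpace ι)} {p q : ProjSpace ι → Prop}
    (hp : HoldsGenerally T p) (h : ∀ H ∈ T, p H → q H) : HoldsGenerally T q := by
  obtain ⟨S, hS, hT, hpS⟩ := hp
  exact ⟨S, hS, hT, fun H hH hHS => h H hH (hpS H hH hHS)⟩

variable {F : MvPolynomial (Fin (r + 1) × Fin d) ℂ}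

theorem exists_mem_cayleyRelations_eval_moments_ne_zero
    (hF : ∃ m ∈ complexifyTuple (sumKernel fun i => diffSpan (A i)),
      eval (Function.uncurry m) F ≠ 0) :
    ∃ a ∈ cayleyRelations A ℂ, eval (Function.uncurry (moments A a)) F ≠ 0 := by
  obtain ⟨m, hm, hFm⟩ := hF
  rw [complexifyTuple_sumKernel_eq_map] at hm
  obtain ⟨a, ha, rfl⟩ := hm
  rw [← moments_eq_blockMoments] at hFm
  exact ⟨a, ha, hFm⟩

theorem holdsGenerally_eval_moments_ne_zero (hne : (cayleySum A).Nonempty)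
    (hF : ∃ m ∈ complexifyTuple (sumKernel fun i => diffSpan (A i)),
      eval (Function.uncurry m) F ≠ 0) :
    HoldsGenerally (tangentHyperplanesAtOne (cayleySum A) hne) fun H =>
      ∃ (a : cayleySum A → ℂ) (ha : a ≠ 0), Projectivization.mk ℂ a ha = H ∧
        eval (Function.uncurry (moments A a)) F ≠ 0 := by
  obtain ⟨a, ha, hFa⟩ := exists_mem_cayleyRelations_eval_moments_ne_zero hF
  simp only [← eval_momentsPullback] at hFa ⊢
  refine holdsGenerally_of_eval_ne_zero ?_ hFa
  rw [affineCone_tangentHyperplanesAtOne]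
  exact ha

variable {I : Ideal (MvPolynomial (Fin (r + 1) × Fin d) ℂ)}

theorem exists_ideal_moments_notMem (hne : (cayleySum A).Nonempty)
    (hI : ¬ (complexifyTuple (sumKernel fun i => diffSpan (A i)) : Set _) ⊆ tupleZeroLocus I) :
    ∃ J : Ideal (MvPolynomial (cayleySum A) ℂ),
      (¬ affineCone (tangentHyperplanesAtOne (cayleySum A) hne) ⊆ zeroLocus ℂ J) ∧
      ∀ a ∈ affineCone (tangentHyperplanesAtOne (cayleySum A) hne),
        a ∉ zeroLocus ℂ J → moments A a ∉ tupleZeroLocus I := by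
  obtain ⟨m, hm, hmI⟩ := Set.not_subset.1 hI
  obtain ⟨F, hFI, hFm⟩ := notMem_tupleZeroLocus.1 hmI
  obtain ⟨a, ha, hFa⟩ := exists_mem_cayleyRelations_eval_moments_ne_zero ⟨m, hm, hFm⟩
  have hzero (b : cayleySum A → ℂ) : b ∈ zeroLocus ℂ (Ideal.span {momentsPullback F}) ↔
      eval (Function.uncurry (moments A b)) F = 0 := by
    rw [zeroLocus_span, ← eval_momentsPullback]
    simp [aeval_eq_eval]
  refine ⟨Ideal.span {momentsPullback F}, fun hsub => ?_, fun b _ hb => ?_⟩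
  · rw [affineCone_tangentHyperplanesAtOne] at hsub
    exact hFa ((hzero a).1 (hsub ha))
  · exact notMem_tupleZeroLocus.2 ⟨F, hFI, mt (hzero b).2 hb⟩

theorem holdsGenerally_moments_notMem (hne : (cayleySum A).Nonempty)
    (hI : ¬ (complexifyTuple (sumKernel fun i => diffSpan (A i)) : Set _) ⊆ tupleZeroLocus I) :
    HoldsGenerally (tangentHyperplanesAtOne (cayleySum A) hne) fun H =>
      ∃ (a : cayleySum A → ℂ) (ha : a ≠ 0),
        Projectivization.mk ℂ a ha = H ∧ moments A a ∉ tupleZeroLocus I := by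
  obtain ⟨m, hm, hmI⟩ := Set.not_subset.1 hI
  obtain ⟨F, hFI, hFm⟩ := notMem_tupleZeroLocus.1 hmI
  refine (holdsGenerally_eval_moments_ne_zero hne ⟨m, hm, hFm⟩).mono fun H _ => ?_
  rintro ⟨a, ha, haH, hFa⟩
  exact ⟨a, ha, haH, notMem_tupleZeroLocus.2 ⟨F, hFI, hFa⟩⟩

end Generic

/-! ### The contact locus along the fibre torus -/

section Fibre

variable {d r : ℕ} {A : Fin (r + 1) → Finset (Fin d → ℤ)}

theorem blockIndex_surjective (hA : ∀ i, (A i).Nonempty) : Function.Surjective (blockIndex A) :=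
  fun i => (hA i).elim fun u hu => ⟨cayleyMk A i ⟨u, hu⟩, blockIndex_cayleyMk A i _⟩

section Scaling

variable {R : Type*} [CommRing R] (a : cayleySum A → R) (s : Fin (r + 1) → R)

theorem blockSum_mul_comp_blockIndex :
    blockSum A R (a * s ∘ blockIndex A) = blockSum A R a * s := by
  ext i
  simp [blockSum_apply, Finset.sum_mul]

theorem blockMoments_mul_comp_blockIndex (i : Fin (r + 1)) :
    blockMoments A R (a * s ∘ blockIndex A) i = s i • blockMoments A R a i := by
  simp [blockMoments_apply, Finset.smul_sum, smul_smul, mul_comm]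

variable {a} in
theorem mul_comp_blockIndex_mem_cayleyRelations (ha : a ∈ cayleyRelations A R) :
    a * s ∘ blockIndex A ∈ cayleyRelations A R ↔ ∑ i, s i • blockMoments A R a i = 0 := by
  simp [mem_cayleyRelations, blockSum_mul_comp_blockIndex, blockMoments_mul_comp_blockIndex,
    (mem_cayleyRelations.1 ha).1]

end Scaling

/-- The homogeneous fibre coordinates `(1, t_1, …, t_r)` of a point of the torus. -/
def fibreCoord (t : Fin d ⊕ Fin r → ℂˣ) : Fin (r + 1) → ℂˣ :=
  Fin.cons 1 (t ∘ Sum.inr)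

theorem torusChar_cayleyPoint (t : Fin d ⊕ Fin r → ℂˣ) (i : Fin (r + 1)) (u : Fin d → ℤ) :
    torusChar t (cayleyPoint i u) = torusChar (t ∘ Sum.inl) u * fibreCoord t i := by
  rw [torusChar, Fintype.prod_sum_type]
  congr 1
  cases i using Fin.cases <;> simp [cayleyPoint, fibreCoord, Fin.succ_ne_zero, eq_comm]

theorem monomialVec_cayleyMk (t : Fin d ⊕ Fin r → ℂˣ) (i : Fin (r + 1)) (u : A i) :
    monomialVec (cayleySum A) t (cayleyMk A i u) =
      (torusChar (t ∘ Sum.inl) (u : Fin d → ℤ) : ℂ) * fibreCoord t i :=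
  (congrArg Units.val (torusChar_cayleyPoint t i u)).trans (Units.val_mul _ _)

theorem monomialVec_of_base_eq_one {t : Fin d ⊕ Fin r → ℂˣ} (ht : ∀ l, t (Sum.inl l) = 1) :
    monomialVec (cayleySum A) t = (fun i => (fibreCoord t i : ℂ)) ∘ blockIndex A := by
  refine _root_.funext (forall_cayleySum.2 fun i u => ?_)
  simp [monomialVec_cayleyMk, torusChar, ht]

variable (hne : (cayleySum A).Nonempty) {a : cayleySum A → ℂ}

theorem mem_openContactLocus_of_base_eq_one (ha : a ≠ 0) (haL : a ∈ cayleyRelations A ℂ)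
    {t : Fin d ⊕ Fin r → ℂˣ} (ht : ∀ l, t (Sum.inl l) = 1) :
    t ∈ openContactLocus (cayleySum A) hne (Projectivization.mk ℂ a ha) ↔
      ∑ i, (fibreCoord t i : ℂ) • moments A a i = 0 := by
  rw [mem_openContactLocus_mk, monomialVec_of_base_eq_one ht, moments_eq_blockMoments]
  exact mul_comp_blockIndex_mem_cayleyRelations _ haL

/-- `Z°_{A,H} ∩ ({1} × (ℂ^×)^r)`, as a subset of projective space. -/
def contactFibre (H : ProjSpace (cayleySum A)) : Set (ProjSpace (cayleySum A)) :=
  torusMap (cayleySum A) hne ''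
    (openContactLocus (cayleySum A) hne H ∩ {t | ∀ l : Fin d, t (Sum.inl l) = 1})

theorem exists_eq_comp_blockIndex_of_mem_affineCone (ha : a ≠ 0) (haL : a ∈ cayleyRelations A ℂ)
    {v : cayleySum A → ℂ}
    (hv : v ∈ affineCone (contactFibre hne (Projectivization.mk ℂ a ha))) :
    ∃ s : Fin (r + 1) → ℂ, ∑ i, s i • moments A a i = 0 ∧ s ∘ blockIndex A = v := by
  by_cases hv0 : v = 0
  · exact ⟨0, by simp, hv0.symm⟩
  · obtain ⟨t, ⟨ht, ht1⟩, htv⟩ := hv hv0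
    obtain ⟨c, rfl⟩ := (Projectivization.mk_eq_mk_iff' ℂ _ _ _ _).1 htv.symm
    refine ⟨c • fun i => (fibreCoord t i : ℂ), ?_, by rw [monomialVec_of_base_eq_one ht1]; rfl⟩
    simp only [Pi.smul_apply, smul_assoc, ← Finset.smul_sum,
      (mem_openContactLocus_of_base_eq_one hne ha haL ht1).1 ht, smul_zero]

theorem comp_blockIndex_mem_affineCone (ha : a ≠ 0) (haL : a ∈ cayleyRelations A ℂ)
    {s : Fin (r + 1) → ℂ} (hs : ∑ i, s i • moments A a i = 0) (hs0 : ∀ i, s i ≠ 0) :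
    s ∘ blockIndex A ∈ affineCone (contactFibre hne (Projectivization.mk ℂ a ha)) := by
  let t : Fin d ⊕ Fin r → ℂˣ :=
    Sum.elim 1 fun k => Units.mk0 (s k.succ / s 0) (div_ne_zero (hs0 _) (hs0 _))
  have ht1 (l : Fin d) : t (Sum.inl l) = 1 := rfl
  have hs_eq (i : Fin (r + 1)) : s i = s 0 * fibreCoord t i := by
    cases i using Fin.cases <;> simp [fibreCoord, t, hs0, mul_div_cancel₀]
  have hvec : s ∘ blockIndex A = s 0 • monomialVec (cayleySum A) t := by
    rw [monomialVec_of_base_eq_one ht1]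
    exact _root_.funext fun w => hs_eq _
  rw [hvec]
  refine smul_mem_affineCone (fun _ => ?_) _
  refine ⟨t, ⟨?_, ht1⟩, rfl⟩
  rw [mem_openContactLocus_of_base_eq_one hne ha haL ht1]
  refine (smul_eq_zero.1 ?_).resolve_left (hs0 0)
  simpa only [Finset.smul_sum, smul_smul, ← hs_eq] using hs

theorem coneDim_contactFibre (hA : ∀ i, (A i).Nonempty) (ha : a ≠ 0)
    (haL : a ∈ cayleyRelations A ℂ) :
    coneDim (contactFibre hne (Projectivization.mk ℂ a ha)) +
      Module.finrank ℂ (Submodule.span ℂ (Set.range (moments A a))) = r + 1 := by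
  let combination := Fintype.linearCombination ℂ (moments A a)
  let blockVec := LinearMap.funLeft ℂ ℂ (blockIndex A)
  have hinj : Function.Injective blockVec :=
    LinearMap.funLeft_injective_of_surjective ℂ ℂ _ (blockIndex_surjective hA)
  have hone : (1 : Fin (r + 1) → ℂ) ∈ LinearMap.ker combination := by
    simpa [combination, Fintype.linearCombination_apply, moments_eq_blockMoments]
      using (mem_cayleyRelations.1 haL).2
  have hdim : coneDim (contactFibre hne (Projectivization.mk ℂ a ha)) =
      Module.finrank ℂ ((LinearMap.ker combination).map blockVec) := by
    refine coneDim_eq_finrank fun F => ⟨fun hF => ?_, fun hF v hv => ?_⟩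
    · rintro _ ⟨s, hs, rfl⟩
      refine eval_map_eq_zero_of_generic (blockVec ∘ₗ (LinearMap.ker combination).subtype)
        (LinearMap.ker combination).subtype (G := ∏ i, X i) (v₀ := ⟨1, hone⟩) (by simp)
        (fun w hw => hF _ (comp_blockIndex_mem_affineCone hne ha haL w.2 fun i => ?_)) ⟨s, hs⟩
      rw [map_prod, Finset.prod_ne_zero_iff] at hw
      simpa using hw i (Finset.mem_univ i)
    · obtain ⟨s, hs, rfl⟩ := exists_eq_comp_blockIndex_of_mem_affineCone hne ha haL hv
      exact hF _ ⟨s, hs, rfl⟩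
  rw [hdim, ← (Submodule.equivMapOfInjective blockVec hinj _).finrank_eq, add_comm,
    ← Fintype.range_linearCombination, LinearMap.finrank_range_add_finrank_ker,
    Module.finrank_fin_fun]

theorem holdsGenerally_projDim_contactFibre (hA : ∀ i, (A i).Nonempty) :
    HoldsGenerally (tangentHyperplanesAtOne (cayleySum A) hne) fun H =>
      projDim (contactFibre hne H) = (r : ℤ) - alphaInv fun i => diffSpan (A i) := by
  obtain ⟨J, F, hJ, hF, hgen⟩ := exists_generic_basis fun i => diffSpan (A i)
  refine (holdsGenerally_eval_moments_ne_zero hne hF).mono ?_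
  rintro _ hH ⟨a, ha, rfl, hFa⟩
  have haL := (mk_mem_tangentHyperplanesAtOne hne ha).1 hH
  obtain ⟨hli, hspan⟩ := hgen _ (moments_mem_complexifyTuple haL) hFa
  have hdim := coneDim_contactFibre hne hA ha haL
  rw [← hspan, finrank_span_eq_card hli, Fintype.card_coe, hJ] at hdim
  rw [projDim]
  lia

end Fibre

/-! ### Dimension of torus translates of a linear space -/

section TorusTranslates

variable {ι τ : Type} [Finite ι] [Fintype τ] {S : Set (ProjSpace ι)}
  {L : Submodule ℂ (ι → ℂ)}

theorem coneDim_le_of_monomial_mul (n : ι → τ → ℕ)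
    (h : ∀ G, (∀ (x : τ → ℂ), ∀ a ∈ L, eval ((fun b => ∏ q, x q ^ n b q) * a) G = 0) →
      G ∈ idealOf S) : coneDim S ≤ Fintype.card τ + Module.finrank ℂ L := by
  classical
  let param : (Fin (Module.finrank ℂ L) → ℂ) →ₗ[ℂ] (ι → ℂ) :=
    L.subtype ∘ₗ (Module.finBasis ℂ L).equivFun.symm.toLinearMap
  let f : MvPolynomial ι ℂ →ₐ[ℂ] MvPolynomial (τ ⊕ Fin (Module.finrank ℂ L)) ℂ :=
    aeval fun b => (∏ q, X (Sum.inl q) ^ n b q) * rename Sum.inr (linearPullback param (X b))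
  have heval (x : τ → ℂ) (y : Fin (Module.finrank ℂ L) → ℂ) (G : MvPolynomial ι ℂ) :
      eval (Sum.elim x y) (f G) = eval ((fun b => ∏ q, x q ^ n b q) * param y) G := by
    rw [← aeval_eq_eval, ← aeval_eq_eval, ← AlgHom.comp_apply]
    congr 1
    ext b
    simp [f, aeval_eq_eval, eval_rename, eval_linearPullback, Function.comp_def]
  refine (coneDim_le_card f fun G hG => h G fun x a ha => ?_).trans_eq (by simp)
  have ha' : param ((Module.finBasis ℂ L).equivFun ⟨a, ha⟩) = a := by simp [param]
  rw [← ha', ← heval, hG, map_zero]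

theorem exists_natCast_eq_add {ι τ : Type*} [Finite ι] [Finite τ] (c : ι → τ → ℤ) :
    ∃ (n : ι → τ → ℕ) (w : ℕ), ∀ b q, (n b q : ℤ) = c b q + w := by
  obtain ⟨w, hw⟩ := (Set.finite_range fun p : ι × τ => (-c p.1 p.2).toNat).bddAbove
  refine ⟨fun b q => (c b q + w).toNat, w, fun b q => ?_⟩
  have : (-c b q).toNat ≤ w := hw ⟨(b, q), rfl⟩
  lia

theorem coneDim_le_of_torusChar_mul (c : ι → τ → ℤ)
    (h : ∀ G, (∀ (x : τ → ℂˣ), ∀ a ∈ L, eval ((fun b => (torusChar x (c b) : ℂ)) * a) G = 0) →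
      G ∈ idealOf S) : coneDim S ≤ Fintype.card τ + Module.finrank ℂ L := by
  obtain ⟨n, w, hn⟩ := exists_natCast_eq_add c
  refine coneDim_le_of_monomial_mul (L := L) n fun G hG => h G fun x a ha => ?_
  rw [← hG (fun q => x q) _ (L.smul_mem (torusChar x fun _ => -w : ℂˣ) ha)]
  congr 2
  ext b
  have hchar : torusChar x (c b) = (∏ q, x q ^ n b q) * torusChar x fun _ => -w := by
    simp only [torusChar, ← Finset.prod_mul_distrib, ← zpow_natCast, ← zpow_add, hn,
      add_neg_cancel_right]
  simp [hchar, mul_assoc]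

end TorusTranslates

/-! ### The dual variety of a Cayley sum -/

theorem exists_retraction_to_relations {k V ι : Type*} [Field k] [AddCommGroup V] [Module k V]
    [Fintype ι] {m : ι → V} {J : Finset ι}
    (hspan : Submodule.span k (Set.range fun j : J => m j) = Submodule.span k (Set.range m)) :
    ∃ σ : (ι → k) →ₗ[k] (ι → k), (∀ s, ∀ i ∉ J, σ s i = s i) ∧ (∀ s, ∑ i, σ s i • m i = 0) ∧
      ∀ s, ∑ i, s i • m i = 0 → σ s = s := by
  classical
  let combination := Fintype.linearCombination k m
  let extend := Fintype.linearCombination k fun j : J => (Pi.single (j : ι) 1 : ι → k)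
  have hrange : LinearMap.range (combination ∘ₗ extend) = LinearMap.range combination := by
    have hcomp : combination ∘ₗ extend = Fintype.linearCombination k fun j : J => m j := by
      ext j
      simp [combination, extend]
    rw [hcomp, Fintype.range_linearCombination, hspan, Fintype.range_linearCombination]
  obtain ⟨g, hg⟩ := (combination ∘ₗ extend).rangeRestrict.exists_rightInverse_of_surjective
    (LinearMap.range_rangeRestrict _)
  let solve := g ∘ₗ combination.codRestrict _ fun s => hrange ▸ LinearMap.mem_range_self _ s
  have hsolve (s : ι → k) : combination (extend (solve s)) = combination s :=
    congrArg Subtype.val (LinearMap.congr_fun hg _)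
  have hsolve_zero {s : ι → k} (hs : combination s = 0) : solve s = 0 :=
    (congrArg g (Subtype.ext hs)).trans (map_zero g)
  refine ⟨LinearMap.id - extend ∘ₗ solve, fun s i hi => ?_, fun s => ?_, fun s hs => ?_⟩
  · have hne (j : J) : i ≠ j := fun h => hi (h ▸ j.2)
    simp [extend, Fintype.linearCombination_apply, hne]
  · change combination (s - extend (solve s)) = 0
    rw [map_sub, hsolve, sub_self]
  · simp [hsolve_zero hs]

section Dual

variable {d r : ℕ} {A : Fin (r + 1) → Finset (Fin d → ℤ)} {J : Finset (Fin (r + 1))}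
  {D : cayleySum A → ℂ} {G : MvPolynomial (cayleySum A) ℂ}

theorem eval_mul_mul_comp_blockIndex_eq_zero_of_span
    (hG : ∀ s : Fin (r + 1) → ℂ, (∀ i, s i ≠ 0) → (∀ i ∉ J, s i = 1) →
      ∀ a ∈ cayleyRelations A ℂ, eval (D * (s ∘ blockIndex A * a)) G = 0)
    {a : cayleySum A → ℂ} (ha : a ∈ cayleyRelations A ℂ)
    (hspan : Submodule.span ℂ (Set.range fun j : J => moments A a j) =
      Submodule.span ℂ (Set.range (moments A a))) (s : Fin (r + 1) → ℂ) :
    eval (D * (s ∘ blockIndex A * a)) G = 0 := by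
  obtain ⟨σ, hσJ, hσ, hσfix⟩ := exists_retraction_to_relations hspan
  have hσ1 : σ 1 = 1 :=
    hσfix 1 (by simpa [moments_eq_blockMoments] using (mem_cayleyRelations.1 ha).2)
  refine eval_map_eq_zero_of_generic
    (LinearMap.mulLeft ℂ D ∘ₗ LinearMap.mulRight ℂ a ∘ₗ LinearMap.funLeft ℂ ℂ (blockIndex A))
    LinearMap.id (G := (∏ i, X i) * linearPullback σ (∏ i, X i)) (v₀ := 1)
    (by simp [hσ1]) (fun s hs => ?_) s
  obtain ⟨hs0, hσ0⟩ : (∀ i, s i ≠ 0) ∧ ∀ i, σ s i ≠ 0 := by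
    simpa [Finset.prod_eq_zero_iff] using hs
  have hmem : σ s ∘ blockIndex A * a ∈ cayleyRelations A ℂ := by
    rw [mul_comm, mul_comp_blockIndex_mem_cayleyRelations _ ha, ← moments_eq_blockMoments]
    exact hσ s
  have hzero := hG (s / σ s) (fun i => div_ne_zero (hs0 i) (hσ0 i))
    (fun i hi => by rw [Pi.div_apply, hσJ s i hi, div_self (hs0 i)]) _ hmem
  have hfactor : s ∘ blockIndex A * a =
      (s / σ s) ∘ blockIndex A * (σ s ∘ blockIndex A * a) := by
    ext b
    simp only [Pi.mul_apply, Function.comp_apply, Pi.div_apply]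
    rw [← mul_assoc, div_mul_cancel₀ _ (hσ0 _)]
  rwa [← hfactor] at hzero

theorem eval_mul_mul_comp_blockIndex_eq_zero {F : MvPolynomial (Fin (r + 1) × Fin d) ℂ}
    (hF : ∃ m ∈ complexifyTuple (sumKernel fun i => diffSpan (A i)),
      eval (Function.uncurry m) F ≠ 0)
    (hspan : ∀ m ∈ complexifyTuple (sumKernel fun i => diffSpan (A i)),
      eval (Function.uncurry m) F ≠ 0 →
        Submodule.span ℂ (Set.range fun j : J => m j) = Submodule.span ℂ (Set.range m))
    (hG : ∀ s : Fin (r + 1) → ℂ, (∀ i, s i ≠ 0) → (∀ i ∉ J, s i = 1) →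
      ∀ a ∈ cayleyRelations A ℂ, eval (D * (s ∘ blockIndex A * a)) G = 0)
    (s : Fin (r + 1) → ℂ) {a : cayleySum A → ℂ} (ha : a ∈ cayleyRelations A ℂ) :
    eval (D * (s ∘ blockIndex A * a)) G = 0 := by
  obtain ⟨a₀, ha₀, hFa₀⟩ := exists_mem_cayleyRelations_eval_moments_ne_zero hF
  refine eval_map_eq_zero_of_generic
    (LinearMap.mulLeft ℂ D ∘ₗ LinearMap.mulLeft ℂ (s ∘ blockIndex A) ∘ₗ
      (cayleyRelations A ℂ).subtype)
    (cayleyRelations A ℂ).subtype (G := momentsPullback F) (v₀ := ⟨a₀, ha₀⟩)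
    (by simpa only [Submodule.subtype_apply, eval_momentsPullback] using hFa₀)
    (fun a hFa => ?_) ⟨a, ha⟩
  rw [Submodule.subtype_apply, eval_momentsPullback] at hFa
  exact eval_mul_mul_comp_blockIndex_eq_zero_of_span hG a.2
    (hspan _ (moments_mem_complexifyTuple a.2) hFa) s

variable (A) in
/-- The map `a ↦ m_0 + ⋯ + m_r`. -/
def totalMoment (R : Type*) [CommRing R] : (cayleySum A → R) →ₗ[R] (Fin d → R) :=
  (∑ i, LinearMap.proj i) ∘ₗ blockMoments A R

theorem totalMoment_apply {R : Type*} [CommRing R] (a : cayleySum A → R) :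
    totalMoment A R a = ∑ i, blockMoments A R a i := by
  simp [totalMoment]

theorem cayleyRelations_eq_inf {R : Type*} [CommRing R] :
    cayleyRelations A R = LinearMap.ker (blockSum A R) ⊓ LinearMap.ker (totalMoment A R) := by
  ext a
  simp [mem_cayleyRelations, totalMoment_apply]

variable (A) in
/-- The lattice `∑ i, ⟨A_i - A_i⟩ ⊆ ℤ^d`, which controls how the base torus moves the contact
locus. -/
def differenceLattice : Submodule ℤ (Fin d → ℤ) :=
  (LinearMap.ker (blockSum A ℤ)).map (totalMoment A ℤ)

theorem sub_mem_differenceLattice {i : Fin (r + 1)} {u v : Fin d → ℤ} (hu : u ∈ A i)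
    (hv : v ∈ A i) : u - v ∈ differenceLattice A := by
  have hpi : Pi.single i (u - v) ∈ (LinearMap.ker (blockSum A ℤ)).map (blockMoments A ℤ) := by
    rw [map_blockMoments_ker_blockSum, Submodule.mem_pi]
    rintro j -
    obtain rfl | hj := eq_or_ne j i
    · rw [Pi.single_eq_same]
      exact vsub_mem_vectorSpan ℤ ⟨⟨u, hu⟩, rfl⟩ ⟨⟨v, hv⟩, rfl⟩
    · rw [Pi.single_eq_of_ne hj]
      exact zero_mem _
  obtain ⟨c, hc, hcm⟩ := hpi
  refine ⟨c, hc, ?_⟩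
  rw [totalMoment_apply, hcm, Finset.sum_pi_single']
  simp

theorem exists_monomialVec_eq_torusChar_mul (hA : ∀ i, (A i).Nonempty) :
    ∃ c : cayleySum A → Fin (Module.finrank ℤ (differenceLattice A)) → ℤ,
      ∀ t, ∃ (x : Fin (Module.finrank ℤ (differenceLattice A)) → ℂˣ) (s : Fin (r + 1) → ℂ),
        monomialVec (cayleySum A) t = (fun b => (torusChar x (c b) : ℂ)) * s ∘ blockIndex A := by
  choose base hbase using hA
  let basis := Module.finBasis ℤ (differenceLattice A)
  have hcoord : ∀ b : cayleySum A, ∃ c : Fin (Module.finrank ℤ (differenceLattice A)) → ℤ, ∀ t,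
      monomialVec (cayleySum A) t b =
        torusChar (fun k => torusChar (t ∘ Sum.inl) (basis k : Fin d → ℤ)) c *
          (torusChar (t ∘ Sum.inl) (base (blockIndex A b)) * fibreCoord t (blockIndex A b)) := by
    refine forall_cayleySum.2 fun i u => ?_
    let δ : differenceLattice A := ⟨_, sub_mem_differenceLattice u.2 (hbase i)⟩
    refine ⟨basis.repr δ, fun t => ?_⟩
    have hδ : ∑ k, basis.repr δ k • (basis k : Fin d → ℤ) = u - base i := by
      have := congrArg Subtype.val (basis.sum_repr δ)
      simpa only [Submodule.coe_sum, Submodule.coe_smul] using this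
    have hchar : torusChar (t ∘ Sum.inl) u =
        torusChar (fun k => torusChar (t ∘ Sum.inl) (basis k)) (basis.repr δ) *
          torusChar (t ∘ Sum.inl) (base i) := by
      rw [← sub_add_cancel (u : Fin d → ℤ) (base i), torusChar_add, ← hδ, torusChar_sum_smul]
      rfl
    rw [monomialVec_cayleyMk, blockIndex_cayleyMk, hchar, Units.val_mul, mul_assoc]
  choose c hc using hcoord
  exact ⟨c, fun t => ⟨_, fun i => torusChar (t ∘ Sum.inl) (base i) * fibreCoord t i,
    _root_.funext fun b => hc b t⟩⟩

theorem blockSum_algebraMap {k R : Type*} [CommRing k] [CommRing R] [Algebra k R]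
    (a : cayleySum A → k) :
    blockSum A R (algebraMap k R ∘ a) = algebraMap k R ∘ blockSum A k a := by
  ext i
  simp [blockSum_apply]

theorem totalMoment_algebraMap {k R : Type*} [CommRing k] [CommRing R] [Algebra k R]
    (a : cayleySum A → k) :
    totalMoment A R (algebraMap k R ∘ a) = algebraMap k R ∘ totalMoment A k a := by
  ext l
  simp [totalMoment_apply, blockMoments_algebraMap]

theorem finrank_differenceLattice_le :
    Module.finrank ℤ (differenceLattice A) ≤
      Module.finrank ℂ ((LinearMap.ker (blockSum A ℂ)).map (totalMoment A ℂ)) := by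
  let basis := Module.finBasis ℤ (differenceLattice A)
  have hbasis : LinearIndependent ℤ fun k => (basis k : Fin d → ℤ) :=
    basis.linearIndependent.map' (differenceLattice A).subtype (Submodule.ker_subtype _)
  have hli := (linearIndependent_algebraMap_comp_iff (S := ℂ)).2 hbasis
  have hmem (k) : algebraMap ℤ ℂ ∘ (basis k : Fin d → ℤ) ∈
      (LinearMap.ker (blockSum A ℂ)).map (totalMoment A ℂ) := by
    obtain ⟨a, ha, hak⟩ := (basis k).2
    refine ⟨algebraMap ℤ ℂ ∘ a, ?_, by rw [totalMoment_algebraMap, hak]⟩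
    rw [SetLike.mem_coe, LinearMap.mem_ker] at ha ⊢
    rw [blockSum_algebraMap, ha, Pi.comp_zero, map_zero]
    rfl
  calc Module.finrank ℤ (differenceLattice A)
      = Module.finrank ℂ (Submodule.span ℂ (Set.range fun k => algebraMap ℤ ℂ ∘ (basis k).1)) := by
        rw [finrank_span_eq_card hli, Fintype.card_fin]
    _ ≤ _ := Submodule.finrank_mono (Submodule.span_le.2 (Set.range_subset_iff.2 hmem))

theorem blockSum_surjective (hA : ∀ i, (A i).Nonempty) :
    Function.Surjective (blockSum A ℂ) := by
  intro s
  have hcard (i) : ((A i).card : ℂ) ≠ 0 := Nat.cast_ne_zero.2 (hA i).card_ne_zero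
  refine ⟨(fun i => s i / (A i).card) ∘ blockIndex A, ?_⟩
  ext i
  simp [blockSum_apply, mul_div_cancel₀, hcard]

theorem finrank_cayleyRelations_add_le (hA : ∀ i, (A i).Nonempty) :
    Module.finrank ℂ (cayleyRelations A ℂ) + (r + 1) +
      Module.finrank ℤ (differenceLattice A) ≤ (cayleySum A).card := by
  have hblock := LinearMap.finrank_range_add_finrank_ker (blockSum A ℂ)
  rw [LinearMap.range_eq_top.2 (blockSum_surjective hA), finrank_top, Module.finrank_fin_fun,
    Module.finrank_fintype_fun_eq_card, Fintype.card_coe] at hblock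
  have htotal := LinearMap.finrank_range_add_finrank_ker
    ((totalMoment A ℂ).domRestrict (LinearMap.ker (blockSum A ℂ)))
  have hker : (LinearMap.ker ((totalMoment A ℂ).domRestrict (LinearMap.ker (blockSum A ℂ)))).map
      (LinearMap.ker (blockSum A ℂ)).subtype = cayleyRelations A ℂ := by
    rw [LinearMap.ker_domRestrict, Submodule.map_comap_subtype, cayleyRelations_eq_inf]
  rw [LinearMap.range_domRestrict, ← Submodule.finrank_map_subtype_eq, hker] at htotal
  have := finrank_differenceLattice_le (A := A)
  lia

theorem eval_eq_zero_of_mem_conormalSpace_toricVariety (hne : (cayleySum A).Nonempty)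
    {κ : Type} [Fintype κ] {c : cayleySum A → κ → ℤ}
    (hc : ∀ t, ∃ (x : κ → ℂˣ) (s : Fin (r + 1) → ℂ),
      monomialVec (cayleySum A) t = (fun b => (torusChar x (c b) : ℂ)) * s ∘ blockIndex A)
    (hG : ∀ (x : κ → ℂˣ) (s : Fin (r + 1) → ℂ), ∀ a ∈ cayleyRelations A ℂ,
      eval ((fun b => (torusChar x (c b) : ℂ)) * (s ∘ blockIndex A * a)) G = 0)
    {P : ProjSpace (cayleySum A)} (hP : P ∈ toricVariety (cayleySum A) hne)
    {a : cayleySum A → ℂ}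
    (ha : a ∈ conormalSpace (toricVariety (cayleySum A) hne) P.rep) : eval a G = 0 := by
  refine eval_eq_zero_of_mem_conormalSpace ?_ hP ha
  rintro p hp ⟨t, ht⟩ a ha
  obtain ⟨z, rfl⟩ := (Projectivization.mk_eq_mk_iff ℂ _ _ hp (monomialVec_ne_zero hne t)).1 ht.symm
  rw [Units.smul_def, conormalSpace_smul z.ne_zero, mem_conormalSpace_toricVariety] at ha
  obtain ⟨x, s, hxs⟩ := hc t⁻¹
  have hinv : monomialVec (cayleySum A) t⁻¹ * monomialVec (cayleySum A) t = 1 := by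
    have hchar (v : Fin d ⊕ Fin r → ℤ) : torusChar t⁻¹ v * torusChar t v = 1 := by
      simp only [torusChar, Pi.inv_apply, inv_zpow, Finset.prod_inv_distrib, inv_mul_cancel]
    exact _root_.funext fun b => congrArg Units.val (hchar b)
  rw [← hG x s _ ha, ← mul_assoc, ← hxs, mul_left_comm, hinv, mul_one]

theorem torusChar_sumElim {τ κ : Type} [Fintype τ] [Fintype κ] (x : τ → ℂˣ) (y : κ → ℂˣ)
    (v : τ → ℤ) (w : κ → ℤ) :
    torusChar (Sum.elim x y) (Sum.elim v w) = torusChar x v * torusChar y w :=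
  Fintype.prod_sum_type _

theorem torusChar_ite_mem {κ : Type} [DecidableEq κ] {J : Finset κ} {y : κ → ℂˣ}
    (hy : ∀ i ∉ J, y i = 1) (i : κ) :
    torusChar (fun j : J => y j) (fun j => if i = j then 1 else 0) = y i := by
  have hpow (j : κ) : (y j ^ (if i = j then 1 else 0 : ℤ)) = if i = j then y j else 1 := by
    split_ifs <;> simp
  simp only [torusChar, hpow]
  rw [Finset.prod_coe_sort J fun j => if i = j then y j else 1, Finset.prod_ite_eq]
  exact ite_eq_left_iff.2 fun hi => (hy i hi).symm

theorem coneDim_dualVariety_le (hne : (cayleySum A).Nonempty) (hA : ∀ i, (A i).Nonempty) :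
    coneDim (dualVariety (toricVariety (cayleySum A) hne)) ≤
      Module.finrank ℤ (differenceLattice A) + alphaInv (fun i => diffSpan (A i)) +
        Module.finrank ℂ (cayleyRelations A ℂ) := by
  obtain ⟨J, F, hJ, hF, hgen⟩ := exists_generic_basis fun i => diffSpan (A i)
  obtain ⟨c, hc⟩ := exists_monomialVec_eq_torusChar_mul hA
  let chars : cayleySum A → Fin (Module.finrank ℤ (differenceLattice A)) ⊕ J → ℤ := fun b =>
    Sum.elim (c b) fun j => if blockIndex A b = j then 1 else 0
  rw [dualVariety, coneDim_zariskiClosure]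
  refine (coneDim_le_of_torusChar_mul (L := cayleyRelations A ℂ) chars fun G hG => ?_).trans_eq
    (by simp [hJ])
  have hmain (x) (s : Fin (r + 1) → ℂ) (a) (ha : a ∈ cayleyRelations A ℂ) :
      eval ((fun b => (torusChar x (c b) : ℂ)) * (s ∘ blockIndex A * a)) G = 0 := by
    refine eval_mul_mul_comp_blockIndex_eq_zero hF (fun m hm hFm => (hgen m hm hFm).2)
      (fun s hs hsJ a ha => ?_) s ha
    let y i := Units.mk0 (s i) (hs i)
    have hy : ∀ i ∉ J, y i = 1 := fun i hi => Units.ext (hsJ i hi)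
    rw [← hG (Sum.elim x fun j => y j) a ha, ← mul_assoc]
    simp only [chars, torusChar_sumElim, torusChar_ite_mem hy, Units.val_mul]
    rfl
  refine mem_idealOf.2 fun v hv => ?_
  by_cases hv0 : v = 0
  · have := hmain 1 0 0 (zero_mem _)
    simpa [hv0] using this
  · obtain ⟨P, hP, hvP⟩ := hv hv0
    rw [← P.mk_rep, isTangentAt_mk_mk hv0 P.rep_nonzero] at hvP
    exact eval_eq_zero_of_mem_conormalSpace_toricVariety hne hc hmain hP.1 hvP

theorem le_dualDefect (hne : (cayleySum A).Nonempty) (hA : ∀ i, (A i).Nonempty) :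
    (r : ℤ) - alphaInv (fun i => diffSpan (A i)) ≤
      dualDefect (toricVariety (cayleySum A) hne) := by
  have hdual := coneDim_dualVariety_le hne hA
  have hrel := finrank_cayleyRelations_add_le hA
  rw [dualDefect, projDim, Fintype.card_coe]
  lia

end Dual

/-! ### Projections of join type -/

theorem alphaInv_le_finrank {k V : Type} [Field k] [AddCommGroup V] [Module k V] {r : ℕ}
    {W : Fin (r + 1) → Submodule k V} {U : Submodule k V} [Module.Finite k U]
    (h : ∀ m ∈ sumKernel W, ∀ i, m i ∈ U) : alphaInv W ≤ Module.finrank k U := by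
  refine csSup_le' ?_
  rintro _ ⟨m, hm, rfl⟩
  exact Submodule.finrank_mono (Submodule.span_le.2 (Set.range_subset_iff.2 (h m hm)))

theorem IsJoinType.eq_zero {e r : ℕ} {B : Fin (r + 1) → Finset (Fin e → ℤ)} (hB : IsJoinType B)
    {z : Fin (r + 1) → Fin e → ℤ}
    (hz : ∀ i, z i ∈ AddSubgroup.closure ((B i : Set (Fin e → ℤ)) - (B i : Set (Fin e → ℤ))))
    (hsum : ∑ i, z i = 0) : z = 0 := by
  have h := @hB (fun i => ⟨z i, hz i⟩) 0 (hsum.trans (by simp))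
  exact _root_.funext fun i => congrArg Subtype.val (congrFun h i)

theorem finrank_ker_mulVecLin_intCast {c d e : ℕ} {M : Matrix (Fin e) (Fin d) ℤ}
    (hde : d = e + c) (hM : Function.Surjective M.mulVec) :
    Module.finrank ℚ (LinearMap.ker (M.map (Int.cast : ℤ → ℚ)).mulVecLin) = c := by
  obtain ⟨N, hMN⟩ := Matrix.mulVec_surjective_iff_exists_right_inverse.1 hM
  have hsurj : Function.Surjective (M.map (Int.cast : ℤ → ℚ)).mulVecLin := by
    refine Matrix.mulVec_surjective_iff_exists_right_inverse.2 ⟨N.map (Int.castRingHom ℚ), ?_⟩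
    change M.map (Int.castRingHom ℚ) * _ = (1 : Matrix (Fin e) (Fin e) ℚ)
    rw [← Matrix.map_mul, hMN, Matrix.map_one _ (map_zero _) (map_one _)]
  have hrank := LinearMap.finrank_range_add_finrank_ker (M.map (Int.cast : ℤ → ℚ)).mulVecLin
  rw [LinearMap.range_eq_top.2 hsurj, finrank_top, Module.finrank_fin_fun,
    Module.finrank_fin_fun] at hrank
  lia

section Join

variable {d e r : ℕ} {A : Fin (r + 1) → Finset (Fin d → ℤ)} {p : (Fin d → ℤ) →+ (Fin e → ℤ)}

theorem blockMoments_mem_closure {a : cayleySum A → ℤ} (ha : a ∈ cayleyRelations A ℤ)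
    (i : Fin (r + 1)) : blockMoments A ℤ a i ∈
      AddSubgroup.closure ((A i : Set (Fin d → ℤ)) - (A i : Set (Fin d → ℤ))) := by
  have hmem : blockMoments A ℤ a ∈ (LinearMap.ker (blockSum A ℤ)).map (blockMoments A ℤ) :=
    Submodule.mem_map_of_mem (mem_cayleyRelations.1 ha).1
  rw [map_blockMoments_ker_blockSum] at hmem
  have hrange : Set.range (fun u : A i => (Int.cast ∘ u : Fin d → ℤ)) = A i := Subtype.range_coe
  rw [← Submodule.span_int_eq_addSubgroupClosure, ← hrange]
  exact hmem i (Set.mem_univ i)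

theorem IsJoinType.map_blockMoments_eq_zero (hp : IsJoinType fun i => (A i).image p)
    {a : cayleySum A → ℤ} (ha : a ∈ cayleyRelations A ℤ) (i : Fin (r + 1)) :
    p (blockMoments A ℤ a i) = 0 := by
  refine congrFun (hp.eq_zero (z := fun i => p (blockMoments A ℤ a i)) (fun i => ?_) ?_) i
  · rw [Finset.coe_image, ← Set.image_sub, ← AddMonoidHom.map_closure]
    exact AddSubgroup.mem_map_of_mem p (blockMoments_mem_closure ha i)
  · rw [← map_sum, (mem_cayleyRelations.1 ha).2, map_zero]

theorem alphaInv_le_of_isJoinType_image {c : ℕ} (hde : d = e + c) (hp : Function.Surjective p)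
    (hjoin : IsJoinType fun i => (A i).image p) : alphaInv (fun i => diffSpan (A i)) ≤ c := by
  let M := LinearMap.toMatrix' p.toIntLinearMap
  have hM (z : Fin d → ℤ) : M *ᵥ z = p z := LinearMap.toMatrix'_mulVec _ _
  rw [← finrank_ker_mulVecLin_intCast (M := M) hde (by simpa [Function.Surjective, hM] using hp)]
  refine alphaInv_le_finrank fun m hm i => ?_
  rw [sumKernel_diffSpan_eq_map, cayleyRelations_eq_span ℤ] at hm
  obtain ⟨a, ha, rfl⟩ := hm
  suffices h : Submodule.span ℚ ((fun a => algebraMap ℤ ℚ ∘ a) '' (cayleyRelations A ℤ : Set _)) ≤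
      LinearMap.ker ((M.map (Int.cast : ℤ → ℚ)).mulVecLin ∘ₗ LinearMap.proj i ∘ₗ
        blockMoments A ℚ) from h ha
  refine Submodule.span_le.2 ?_
  rintro _ ⟨z, hz, rfl⟩
  have hcast := RingHom.map_mulVec (algebraMap ℤ ℚ) M (blockMoments A ℤ z i)
  change M.map (algebraMap ℤ ℚ) *ᵥ blockMoments A ℚ (algebraMap ℤ ℚ ∘ z) i = 0
  rw [blockMoments_algebraMap]
  ext j
  rw [← hcast, hM, hjoin.map_blockMoments_eq_zero hz]
  simp

end Join

section Nonempty

variable {d r : ℕ} {A : Fin (r + 1) → Finset (Fin d → ℤ)}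

theorem cayleySum_nonempty (hA : ∀ i, (A i).Nonempty) : (cayleySum A).Nonempty :=
  (hA 0).elim fun u hu => ⟨_, cayleyPoint_mem A 0 ⟨u, hu⟩⟩

theorem eq_zero_of_closure_sub_eq_top {G H : Type*} [AddCommGroup G] [AddCommGroup H] {S : Set G}
    (hS : AddSubgroup.closure (S - S) = ⊤) {f : G →+ H} {h : H} (hf : ∀ x ∈ S, f x = h) :
    f = 0 := by
  refine AddMonoidHom.eq_of_eqOn_dense hS ?_
  rintro _ ⟨x, hx, y, hy, rfl⟩
  simp [hf x hx, hf y hy]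

theorem nonempty_of_closure_cayleySum_sub_eq_top (hne : (cayleySum A).Nonempty)
    (hspan : AddSubgroup.closure ((cayleySum A : Set (Fin d ⊕ Fin r → ℤ)) -
      (cayleySum A : Set (Fin d ⊕ Fin r → ℤ))) = ⊤) (i : Fin (r + 1)) : (A i).Nonempty := by
  by_contra! hi
  have hmem : ∀ w ∈ cayleySum A, ∃ j ≠ i, ∃ u, cayleyPoint j u = w := by
    intro w hw
    obtain ⟨j, -, hj⟩ := Finset.mem_biUnion.1 hw
    obtain ⟨u, hu, rfl⟩ := Finset.mem_image.1 hj
    exact ⟨j, fun h => by simp [h, hi] at hu, u, rfl⟩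
  induction i using Fin.cases with
  | zero =>
    obtain ⟨w, hw⟩ := hne
    obtain ⟨j, hj, -⟩ := hmem w hw
    obtain ⟨k, rfl⟩ := Fin.exists_succ_eq.2 hj
    have hsum : ∑ l, Pi.evalAddMonoidHom (fun _ : Fin d ⊕ Fin r => ℤ) (Sum.inr l) = 0 := by
      refine eq_zero_of_closure_sub_eq_top (h := 1) hspan fun w hw => ?_
      obtain ⟨j, hj, u, rfl⟩ := hmem w hw
      obtain ⟨l, rfl⟩ := Fin.exists_succ_eq.2 hj
      simp [cayleyPoint]
    simpa [Pi.single_apply] using DFunLike.congr_fun hsum (Pi.single (Sum.inr k) 1)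
  | succ k =>
    have hcoord : Pi.evalAddMonoidHom (fun _ : Fin d ⊕ Fin r => ℤ) (Sum.inr k) = 0 := by
      refine eq_zero_of_closure_sub_eq_top (h := 0) hspan fun w hw => ?_
      obtain ⟨j, hj, u, rfl⟩ := hmem w hw
      simp [cayleyPoint, hj]
    simpa using DFunLike.congr_fun hcoord (Pi.single (Sum.inr k) 1)

end Nonempty

end CayleyContact

end

open CayleyContact in
theorem mainTheorem6_general (d r : ℕ) (A : Fin (r + 1) → Finset (Fin d → ℤ))
    (hA : ∀ i, (A i).Nonempty) :
    (∀ (a : cayleySum A → ℂ) (ha : a ≠ 0),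
      Projectivization.mk ℂ a ha ∈
          tangentHyperplanesAtOne (cayleySum A) (cayleySum_nonempty hA) →
        (∀ i, moments A a i ∈ complexify (diffSpan (A i))) ∧
        moments A a ∈ complexifyTuple (sumKernel fun i => diffSpan (A i))) ∧
    (∀ I : Ideal (MvPolynomial (Fin (r + 1) × Fin d) ℂ),
      (¬ (complexifyTuple (sumKernel fun i => diffSpan (A i)) :
            Set (Fin (r + 1) → Fin d → ℂ)) ⊆ tupleZeroLocus I) →
        (∃ J : Ideal (MvPolynomial (cayleySum A) ℂ),
          (¬ affineCone (tangentHyperplanesAtOne (cayleySum A) (cayleySum_nonempty hA)) ⊆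
            MvPolynomial.zeroLocus ℂ J) ∧
          ∀ a ∈ affineCone (tangentHyperplanesAtOne (cayleySum A) (cayleySum_nonempty hA)),
            a ∉ MvPolynomial.zeroLocus ℂ J → moments A a ∉ tupleZeroLocus I) ∧
        HoldsGenerally (tangentHyperplanesAtOne (cayleySum A) (cayleySum_nonempty hA))
          (fun H => ∃ (a : cayleySum A → ℂ) (ha : a ≠ 0),
            Projectivization.mk ℂ a ha = H ∧ moments A a ∉ tupleZeroLocus I)) ∧
    HoldsGenerally (tangentHyperplanesAtOne (cayleySum A) (cayleySum_nonempty hA))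
      (fun H =>
        projDim (torusMap (cayleySum A) (cayleySum_nonempty hA) ''
            (openContactLocus (cayleySum A) (cayleySum_nonempty hA) H ∩
              {t | ∀ l : Fin d, t (Sum.inl l) = 1})) =
          (r : ℤ) - alphaInv fun i => diffSpan (A i)) ∧
    (r : ℤ) - alphaInv (fun i => diffSpan (A i)) ≤
      dualDefect (toricVariety (cayleySum A) (cayleySum_nonempty hA)) ∧
    (∀ (c e : ℕ) (p : (Fin d → ℤ) →+ (Fin e → ℤ)), d = e + c → Function.Surjective p →
      IsJoinType (fun i => (A i).image p) →
        alphaInv (fun i => diffSpan (A i)) ≤ c ∧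
        (r : ℤ) - c ≤ dualDefect (toricVariety (cayleySum A) (cayleySum_nonempty hA))) := by
  have hne := cayleySum_nonempty hA
  have hdefect := le_dualDefect hne hA
  refine ⟨fun a ha hH => ?_, fun I hI => ⟨exists_ideal_moments_notMem hne hI,
    holdsGenerally_moments_notMem hne hI⟩, holdsGenerally_projDim_contactFibre hne hA, hdefect,
    fun c e p hde hp hjoin => ?_⟩
  · have hm := moments_mem_complexifyTuple ((mk_mem_tangentHyperplanesAtOne hne ha).1 hH)
    exact ⟨apply_mem_complexify hm, hm⟩
  · have hα := alphaInv_le_of_isJoinType_image hde hp hjoin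
    exact ⟨hα, by lia⟩

theorem mainTheorem6 (d r : ℕ) (A : Fin (r + 1) → Finset (Fin d → ℤ))
    (hne : (CayleyContact.cayleySum A).Nonempty)
    (hspan : AddSubgroup.closure
      ((CayleyContact.cayleySum A : Set (Fin d ⊕ Fin r → ℤ)) -
        (CayleyContact.cayleySum A : Set (Fin d ⊕ Fin r → ℤ))) = ⊤) :
    -- (i) `m_i ∈ (V_i)_ℂ` and `(m_0, …, m_r) ∈ K_ℂ` whenever `[a]` is tangent at the unit
    (∀ (a : CayleyContact.cayleySum A → ℂ) (ha : a ≠ 0),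
      Projectivization.mk ℂ a ha ∈
          CayleyContact.tangentHyperplanesAtOne (CayleyContact.cayleySum A) hne →
        (∀ i, CayleyContact.moments A a i ∈
          CayleyContact.complexify (CayleyContact.diffSpan (A i))) ∧
        CayleyContact.moments A a ∈ CayleyContact.complexifyTuple
          (CayleyContact.sumKernel fun i => CayleyContact.diffSpan (A i))) ∧
    -- (ii) `(m_0, …, m_r)` is general in `K_ℂ` for general `H`: it avoids any given proper
    -- algebraic subset of `K_ℂ`, for a general coefficient vector, and for a suitable
    -- equation of a general hyperplane
    (∀ I : Ideal (MvPolynomial (Fin (r + 1) × Fin d) ℂ),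
      (¬ (CayleyContact.complexifyTuple
          (CayleyContact.sumKernel fun i => CayleyContact.diffSpan (A i)) :
            Set (Fin (r + 1) → Fin d → ℂ)) ⊆ CayleyContact.tupleZeroLocus I) →
        (∃ J : Ideal (MvPolynomial (CayleyContact.cayleySum A) ℂ),
          (¬ CayleyContact.affineCone
              (CayleyContact.tangentHyperplanesAtOne (CayleyContact.cayleySum A) hne) ⊆
            MvPolynomial.zeroLocus ℂ J) ∧
          ∀ a ∈ CayleyContact.affineCone
              (CayleyContact.tangentHyperplanesAtOne (CayleyContact.cayleySum A) hne),
            a ∉ MvPolynomial.zeroLocus ℂ J →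
              CayleyContact.moments A a ∉ CayleyContact.tupleZeroLocus I) ∧
        CayleyContact.HoldsGenerally
          (CayleyContact.tangentHyperplanesAtOne (CayleyContact.cayleySum A) hne)
          (fun H => ∃ (a : CayleyContact.cayleySum A → ℂ) (ha : a ≠ 0),
            Projectivization.mk ℂ a ha = H ∧
              CayleyContact.moments A a ∉ CayleyContact.tupleZeroLocus I)) ∧
    -- (iii) the dimension of `Z°_{A,H} ∩ ({1} × (ℂ^×)^r)` for general `H`, and the bound
    CayleyContact.HoldsGenerally
      (CayleyContact.tangentHyperplanesAtOne (CayleyContact.cayleySum A) hne)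
      (fun H =>
        CayleyContact.projDim (CayleyContact.torusMap (CayleyContact.cayleySum A) hne ''
            (CayleyContact.openContactLocus (CayleyContact.cayleySum A) hne H ∩
              {t | ∀ l : Fin d, t (Sum.inl l) = 1})) =
          (r : ℤ) - CayleyContact.alphaInv fun i => CayleyContact.diffSpan (A i)) ∧
    (r : ℤ) - CayleyContact.alphaInv (fun i => CayleyContact.diffSpan (A i)) ≤
      CayleyContact.dualDefect (CayleyContact.toricVariety (CayleyContact.cayleySum A) hne) ∧
    -- (iv)
    (∀ (c e : ℕ) (p : (Fin d → ℤ) →+ (Fin e → ℤ)), d = e + c → Function.Surjective p →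
      CayleyContact.IsJoinType (fun i => (A i).image p) →
        CayleyContact.alphaInv (fun i => CayleyContact.diffSpan (A i)) ≤ c ∧
        (r : ℤ) - c ≤
          CayleyContact.dualDefect
            (CayleyContact.toricVariety (CayleyContact.cayleySum A) hne)) :=
  mainTheorem6_general d r A (CayleyContact.nonempty_of_closure_cayleySum_sub_eq_top hne hspan)
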